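/- **Setting.** Let $d,H\ge 1$ and consider an episodic Markov decision process with disjoint state sets $\mathcal S_1,\dots,\mathcal S_H$, an initial distribution on $\mathcal S_1$, transition laws $P(\cdot\mid s,a)$ and independent random instant rewards $R(s,a)$ with mean $r(s,a)$. Every state $s$ has a feature vector $\varphi(s)\in\mathbb R^d$ and a radius $\rho(s)>0$; the actions available in $s$ are the $a\in\mathbb R^d$ with $\|a\|_2\le\rho(s)$, and $\varphi(s,a)=\varphi(s)+a$. A policy chooses an available action $\pi(s)$ for every $s$; $V^\pi_h$, $Q^\pi_h$ are its value functions, $V^*_h=\sup_\pi V_h^\pi$, $Q_h^*=\sup_\pi Q_h^\pi$ (all expectations involved are assumed to exist). A policy is $\epsilon$-optimal if $|\mathbb E[V_1^\pi(s_1)]-\mathbb E[V_1^*(s_1)]|\le\epsilon$. Assume: 1. there are $\theta_1^*,\dots,\theta_H^*\in\mathbb R^d$ with $Q_h^*(s,a)=\langle\varphi(s,a),\theta_h^*\rangle$ for all $h$, $s\in\mathcal S_h$ and available $a$; 2. $\|\varphi(s,a)\|_2\le 1$ for all $s$ and available $a$; $\|\theta_1^*\|_2=\dots=\|\theta_H^*\|_2=\Theta$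 for some $\Theta\in[0,1]$; and along every trajectory (almost surely under every policy) $0\le\sum_{h=1}^H R(s_h,a_h)\le 1$ and $0\le\sum_{h=1}^H\rho(s_h)\le 1$. The learner knows none of $P,r,\varphi,\theta^*,\Theta$; when it runs a policy for one trajectory it observes only the radii $\rho(s_1),\dots,\rho(s_H)$ and the total reward $\sum_h R(s_h,a_h)$. **Algorithm DiffR-BallRL** (input $M_1,M_2,L,\varepsilon,\eta$). For a vector $w$, the greedy action in $s$ for $w$ is the maximizer $\rho(s)w/\|w\|_2$ of $\langle a,w\rangle$ over $\|a\|_2\le\rho(s)$, and $0$ if $w=0$. Start with $\rho_h=0$, $\rho_h^l=1$ and $\hat\theta_h^l=0$ for $1\le h\le H$, $1\le l\le L$; throughout, $\pi_l'$ is the policy that is greedy for $\hat\theta^l_h$ at each step $h$. While there are $h,l$ with $\rho_h^l\ge 2\rho_h$ and $\rho_h^l\ge\varepsilon$: * select such a pair $(h,l)$, by any measurable rule that depends on the current memory of the algorithm and that in the first round selects a pair with $h=1$; * let $\pi_{h,0}$ follow $\pi'_l$ before step $h$ and play $0$ from step $h$ on, and let $\pi_{h,i}$ ($1\le i\le d$)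 follow $\pi'_l$ before step $h$, play $\rho(s)\mathbf e_i$ at step $h$ and $0$ afterwards; collect $M_1$ independent trajectories from each $\pi_{h,i}$, $0\le i\le d$, and let $R_{h,i}$ and $s_{h,i}$ be the averages of the total reward and of $\sum_{h'=2}^H\rho(s_{h'})$; * set $\rho_h\leftarrow\rho_h^l$ and, for all $1\le l'\le L$ and $1\le i\le d$, let the $i$-th coordinate of $\hat\theta_h^{l'}$ be $\bigl((s_{h,i}-s_{h,0})\,l'\eta+R_{h,i}-R_{h,0}\bigr)/\rho_h$; * run each of the new policies $\pi'_1,\dots,\pi'_L$ for $M_2$ independent trajectories; let $R_{l'}$ be the average total reward and $\rho_{h'}^{l'}$ the average of $\rho(s_{h'})$ under $\pi'_{l'}$; let $\pi=\pi'_{l'}$ for an $l'$ that maximizes $R_{l'}$ (ties are broken by any measurable rule). When the loop ends, output $\pi$ (if the body was never executed, the policy that always plays $0$). **Theorem.** There are universal constants $C>0$ and $k\in\mathbb N$ such that the following holds for every such process, all $\epsilon>0$ and $0<\delta<1$, and all selection and tie-breaking rules as above. Let $$\varepsilon=\frac{\epsilon}{8H},\quad \eta=\frac{\epsilon}{8Hd},\quad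 L=\Bigl\lceil\frac1\eta\Bigr\rceil,\quad \delta'=\frac{\delta}{(d+3HL)(1+H\log_2(1/\varepsilon))},$$ $$M_1=\Bigl\lceil 2\log(1/\delta')\cdot\frac{256H^2d^2}{\epsilon^2}\Bigr\rceil,\qquad M_2=\Bigl\lceil 2\log(1/\delta')\cdot\frac{16(2+4H+2Hd)^2}{\epsilon^2}\Bigr\rceil .$$ Then, almost surely, DiffR-BallRL ends after a bounded number of rounds and has used at most $$C\Bigl(1+\log\frac{dH(1+1/\epsilon)}{\delta}\Bigr)^{k}\cdot\frac{H^5d^3}{\epsilon^3}=\tilde{\mathcal O}\Bigl(\frac{H^5d^3}{\epsilon^3}\Bigr)$$ trajectories, and with probability at least $1-\delta$ its output is an $\epsilon$-optimal policy. (In the case $\epsilon>8H$, where $\varepsilon>1$, the loop is never entered and $M_1,M_2,\delta'$ play no role.) -/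

import Mathlib

open MeasureTheory ProbabilityTheory

noncomputable section

namespace BallRL

universe u

/-- The feature space `ℝ^d` with its Euclidean norm; actions are its elements. -/
abbrev Vec (d : ℕ) := EuclideanSpace ℝ (Fin d)

/-- A layered Markov decision process with ball action sets. Steps are numbered from `0`: the states
of step `h` form the type `S h` (so the state sets of different steps are disjoint), the steps that
matter are `h < H`, and the states beyond them are dummies. In state `s` the available
actions are the `a` with `‖a‖ ≤ radius h s`, and the feature of `(s, a)` is `center h s + a`.
The kernels are given on all pairs `(s, a)`, but only available actions are ever played. -/
structure MDP (d : ℕ) (S : ℕ → Type u) [∀ h, MeasurableSpace (S h)] where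
  /-- initial state distribution -/
  init : Measure (S 0)
  /-- law of the next state given the current state and action -/
  trans : ∀ h, Kernel (S h × Vec d) (S (h + 1))
  /-- law of the random instant reward `R(s, a)` -/
  reward : ∀ h, Kernel (S h × Vec d) ℝ
  /-- the feature vector of a state -/
  center : ∀ h, S h → Vec d
  /-- the radius of the action ball of a state -/
  radius : ∀ h, S h → ℝ
  init_prob : IsProbabilityMeasure init
  trans_prob : ∀ h, IsMarkovKernel (trans h)
  reward_prob : ∀ h, IsMarkovKernel (reward h)
  center_meas : ∀ h, Measurable (center h)
  radius_meas : ∀ h, Measurable (radius h)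
  radius_pos : ∀ h s, 0 < radius h s

attribute [instance] MDP.init_prob MDP.trans_prob MDP.reward_prob

variable {d : ℕ} {S : ℕ → Type u} [∀ h, MeasurableSpace (S h)]

/-- A (deterministic, measurable) policy: an available action for every state. -/
structure Policy (M : MDP d S) where
  act : ∀ h, S h → Vec d
  meas : ∀ h, Measurable (act h)
  mem : ∀ h s, ‖act h s‖ ≤ M.radius h s

/-- The expected reward `r(s, a) = E[R(s, a)]`. -/
def MDP.r (M : MDP d S) (h : ℕ) (s : S h) (a : Vec d) : ℝ := ∫ x, x ∂(M.reward h (s, a))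

/-- Expected total reward of the `n` steps that start with step `h` in state `s`. -/
def MDP.valueAux (M : MDP d S) (π : Policy M) : ℕ → (h : ℕ) → S h → ℝ
  | 0, _, _ => 0
  | n + 1, h, s =>
      M.r h s (π.act h s) + ∫ s', M.valueAux π n (h + 1) s' ∂(M.trans h (s, π.act h s))

/-- The value function `V_h^π` for horizon `H`; it vanishes for `h ≥ H`. -/
def MDP.V (M : MDP d S) (H : ℕ) (π : Policy M) (h : ℕ) (s : S h) : ℝ := M.valueAux π (H - h) h s

/-- The function `Q_h^π`, for `h < H`. -/
def MDP.Q (M : MDP d S) (H : ℕ) (π : Policy M) (h : ℕ) (s : S h) (a : Vec d) : ℝ :=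
  M.r h s a + ∫ s', M.V H π (h + 1) s' ∂(M.trans h (s, a))

/-- The optimal value function `V_h^*`. -/
def MDP.Vstar (M : MDP d S) (H : ℕ) (h : ℕ) (s : S h) : ℝ := ⨆ π : Policy M, M.V H π h s

/-- `π` is `ϵ`-optimal: its value differs from the optimal one by at most `ϵ` (the initial state is
drawn from the initial distribution). -/
def MDP.EpsOptimal (M : MDP d S) (H : ℕ) (ϵ : ℝ) (π : Policy M) : Prop :=
  |(∫ s, M.V H π 0 s ∂M.init) - ∫ s, M.Vstar H 0 s ∂M.init| ≤ ϵ

/-- What is revealed of a trajectory: the radii of the action balls of the visited states (this is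
the same as the action sets), indexed by the step, and the total reward. -/
abbrev Obs := (ℕ → ℝ) × ℝ

/-- Law of the observation of the `n` steps that start with step `h` in state `s`, when the actions
are chosen by `act`. -/
def MDP.obsFrom (M : MDP d S) (act : ∀ h, S h → Vec d) : ℕ → (h : ℕ) → S h → Measure Obs
  | 0, _, _ => Measure.dirac (0, 0)
  | n + 1, h, s =>
      ((M.reward h (s, act h s)).prod
          ((M.trans h (s, act h s)).bind (M.obsFrom act n (h + 1)))).map
        fun q : ℝ × Obs => (Function.update q.2.1 h (M.radius h s), q.1 + q.2.2)

/-- Law of the observation of one trajectory of length `H` under a policy. -/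
def MDP.obsLaw (M : MDP d S) (H : ℕ) (π : Policy M) : Measure Obs :=
  M.init.bind (M.obsFrom π.act H 0)

/-- The standing assumptions. -/
structure Assumptions (M : MDP d S) (H : ℕ) (θ : ℕ → Vec d) (Θ : ℝ) : Prop where
  /-- The mean rewards exist. -/
  reward_int : ∀ h < H, ∀ (s : S h) (a : Vec d), ‖a‖ ≤ M.radius h s →
    Integrable (fun x : ℝ => x) (M.reward h (s, a))
  /-- The expectations in the recursion for the value functions exist. -/
  value_int : ∀ (π : Policy M), ∀ h < H, ∀ (s : S h) (a : Vec d), ‖a‖ ≤ M.radius h s →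
    Integrable (M.V H π (h + 1)) (M.trans h (s, a))
  /-- Linear optimal `Q`-function: `Q_h^*(s, a) = sup_π Q_h^π(s, a) = ⟨φ(s, a), θ_h⟩`. -/
  linear : ∀ h < H, ∀ (s : S h) (a : Vec d), ‖a‖ ≤ M.radius h s →
    IsLUB (Set.range fun π : Policy M => M.Q H π h s a) (inner ℝ (M.center h s + a) (θ h))
  /-- The features are bounded by `1`. -/
  feature_le : ∀ h < H, ∀ (s : S h) (a : Vec d), ‖a‖ ≤ M.radius h s → ‖M.center h s + a‖ ≤ 1
  /-- The parameters have the same norm `Θ ∈ [0, 1]`. -/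
  norm_nonneg : 0 ≤ Θ
  norm_le : Θ ≤ 1
  norm_eq : ∀ h < H, ‖θ h‖ = Θ
  /-- Along trajectories the total reward and the sum of the radii lie in `[0, 1]`. -/
  total : ∀ π : Policy M, ∀ᵐ o ∂(M.obsLaw H π),
    (0 ≤ o.2 ∧ o.2 ≤ 1) ∧ 0 ≤ ∑ h ∈ Finset.range H, o.1 h ∧ ∑ h ∈ Finset.range H, o.1 h ≤ 1

/-- The policy that plays, in each state `s` of step `h`, the maximizer of `⟨a, w h⟩` over
`‖a‖ ≤ radius h s`; where `w h = 0` it plays `0`. -/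
def greedy (M : MDP d S) (w : ℕ → Vec d) : Policy M where
  act h s := (M.radius h s / ‖w h‖) • w h
  meas h := ((M.radius_meas h).div_const _).smul_const _
  mem h s := by
    have hr := (M.radius_pos h s).le
    rw [norm_smul, norm_div, norm_norm, Real.norm_of_nonneg hr]
    rcases eq_or_ne (‖w h‖) 0 with h0 | h0
    · simpa [h0] using hr
    · rw [div_mul_cancel₀ _ h0]

theorem inner_le_greedy (M : MDP d S) (w : ℕ → Vec d) (h : ℕ) (s : S h) (a : Vec d)
    (ha : ‖a‖ ≤ M.radius h s) : inner ℝ a (w h) ≤ inner ℝ ((greedy M w).act h s) (w h) := by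
  have h1 : inner ℝ ((greedy M w).act h s) (w h) = M.radius h s * ‖w h‖ := by
    rw [greedy, real_inner_smul_left, real_inner_self_eq_norm_sq]
    rcases eq_or_ne (‖w h‖) 0 with h0 | h0
    · simp [h0]
    · field_simp
  rw [h1]
  exact (real_inner_le_norm _ _).trans (mul_le_mul_of_nonneg_right ha (norm_nonneg _))

/-- The input of the algorithm. -/
structure Params where
  M₁ : ℕ
  M₂ : ℕ
  L : ℕ
  ε : ℝ
  η : ℝ

/-- The memory of the algorithm between two rounds of its loop. -/
@[ext] structure AlgState (d H L : ℕ) where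
  /-- `ρ_h` -/
  rad : Fin H → ℝ
  /-- `ρ_h^l` -/
  radEst : Fin H → Fin L → ℝ
  /-- the estimates of the parameters; `π_l'` is the greedy policy for the `l`-th ones -/
  est : Fin H → Fin L → Vec d
  /-- the index `l` for which `π = π_l'` -/
  best : Fin L
  /-- number of trajectories collected so far -/
  used : ℕ

variable {H L : ℕ}

/-- The memory as a tuple; only used to endow it with the product `σ`-algebra. -/
def AlgState.toProd (x : AlgState d H L) :
    (Fin H → ℝ) × (Fin H → Fin L → ℝ) × (Fin H → Fin L → Vec d) × Fin L × ℕ :=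
  (x.rad, x.radEst, x.est, x.best, x.used)

instance : MeasurableSpace (AlgState d H L) := MeasurableSpace.comap AlgState.toProd inferInstance

/-- The `l`-th parameter estimates, extended by `0` to steps beyond the horizon. -/
def AlgState.dir (x : AlgState d H L) (l : Fin L) (h : ℕ) : Vec d :=
  if hh : h < H then x.est ⟨h, hh⟩ l else 0

/-- The policy `π_l'`. -/
def AlgState.policy (x : AlgState d H L) (M : MDP d S) (l : Fin L) : Policy M :=
  greedy M (x.dir l)

/-- The exploration policy `π_{h,i}` built from `π_l'`; `i = none` stands for the index `0`. It
follows `π_l'` before step `h`, plays `ρ(s) e_i` (or `0`, if `i = none`) at step `h`, and plays `0`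
afterwards. -/
def AlgState.explore (x : AlgState d H L) (M : MDP d S) (h : Fin H) (l : Fin L)
    (i : Option (Fin d)) : Policy M :=
  greedy M fun h' =>
    if h' < h then x.dir l h'
    else if h' = h then i.elim 0 fun i => EuclideanSpace.single i (1 : ℝ)
    else 0

/-- Initial memory: `ρ_h = 0`, `ρ_h^l = 1`, every policy plays `0`. -/
def AlgState.start (b : Fin L) : AlgState d H L where
  rad _ := 0
  radEst _ _ := 1
  est _ _ := 0
  best := b
  used := 0

/-- The pair `(h, l)` satisfies the condition of the loop. -/
def Admissible (ε : ℝ) (x : AlgState d H L) (p : Fin H × Fin L) : Prop :=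
  2 * x.rad p.1 ≤ x.radEst p.1 p.2 ∧ ε ≤ x.radEst p.1 p.2

/-- The loop ends in this memory. -/
def Halted (ε : ℝ) (x : AlgState d H L) : Prop := ∀ p, ¬ Admissible ε x p

/-- Average over a sample of size `m`. -/
def avg {m : ℕ} {X : Type*} (f : X → ℝ) (o : Fin m → X) : ℝ := (∑ j, f (o j)) / m

/-- The sum of the radii over all steps but the first. -/
def laterRadii (H : ℕ) (o : Obs) : ℝ := ∑ h ∈ Finset.Ico 1 H, o.1 h

/-- Update of `ρ_h` and of the estimates `θ̂_h^l` from the exploration samples, where the `l`-th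
candidate (`l` counted from `0`) for the common norm is `ξ = (l + 1) η`. -/
def AlgState.learn (x : AlgState d H L) (η : ℝ) {m : ℕ} (p : Fin H × Fin L)
    (o : Option (Fin d) → Fin m → Obs) : AlgState d H L :=
  { x with
    rad := Function.update x.rad p.1 (x.radEst p.1 p.2)
    est := Function.update x.est p.1 fun l => WithLp.toLp 2 fun i : Fin d =>
      ((avg (laterRadii H) (o (some i)) - avg (laterRadii H) (o none)) * (((l : ℕ) + 1 : ℝ) * η)
        + avg Prod.snd (o (some i)) - avg Prod.snd (o none)) / x.radEst p.1 p.2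
    used := x.used + (d + 1) * m }

/-- Update of `ρ_h^l` and of the best policy from the samples of the new policies `π_l'`. -/
def AlgState.assess (x : AlgState d H L) (best : (Fin L → ℝ) → Fin L) {m : ℕ}
    (o : Fin L → Fin m → Obs) : AlgState d H L :=
  { x with
    radEst := fun h l => avg (fun ω : Obs => ω.1 h) (o l)
    best := best fun l => avg Prod.snd (o l)
    used := x.used + L * m }

/-- Law of the memory after the body of the loop has been executed for the pair `p = (h, l)`: all
trajectories are independent given the policies that generate them. -/
def bodyLaw (M : MDP d S) (H : ℕ) (q : Params) (best : (Fin q.L → ℝ) → Fin q.L)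
    (p : Fin H × Fin q.L) (x : AlgState d H q.L) : Measure (AlgState d H q.L) :=
  (Measure.pi fun i : Option (Fin d) => Measure.pi fun _ : Fin q.M₁ =>
      M.obsLaw H (x.explore M p.1 p.2 i)).bind fun o =>
    (Measure.pi fun l : Fin q.L => Measure.pi fun _ : Fin q.M₂ =>
      M.obsLaw H ((x.learn q.η p o).policy M l)).map fun o' => (x.learn q.η p o).assess best o'

open Classical in
/-- One round of the loop: nothing happens if the loop has ended; otherwise the body is executed for
the pair that `pick` selects. -/
def roundLaw (M : MDP d S) (H : ℕ) (q : Params) (best : (Fin q.L → ℝ) → Fin q.L)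
    (pick : AlgState d H q.L → Fin H × Fin q.L) (x : AlgState d H q.L) :
    Measure (AlgState d H q.L) :=
  if Halted q.ε x then Measure.dirac x else bodyLaw M H q best (pick x) x

/-- Law of the memory after `n` rounds. -/
def runLaw (M : MDP d S) (H : ℕ) (q : Params) (best : (Fin q.L → ℝ) → Fin q.L)
    (pick : AlgState d H q.L → Fin H × Fin q.L) : ℕ → Measure (AlgState d H q.L)
  | 0 => Measure.dirac (AlgState.start (best 0))
  | n + 1 => (runLaw M H q best pick n).bind (roundLaw M H q best pick)

/-- The policy that the algorithm outputs when it ends with memory `x`. -/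
def AlgState.output (x : AlgState d H L) (M : MDP d S) : Policy M := x.policy M x.best

/-- `best` selects a maximizer. -/
structure IsArgmax (best : (Fin L → ℝ) → Fin L) : Prop where
  meas : Measurable best
  max : ∀ (R : Fin L → ℝ) (l : Fin L), R l ≤ R (best R)

/-- `pick` selects a pair that satisfies the condition of the loop whenever there is one, and it
selects the first step of the horizon in the initial memory, where every step qualifies. -/
structure IsPick (ε : ℝ) (pick : AlgState d H L → Fin H × Fin L) : Prop where
  meas : Measurable pick
  admissible : ∀ x, ¬ Halted ε x → Admissible ε x (pick x)
  first : ∀ b, ((pick (AlgState.start b)).1 : ℕ) = 0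

/-- The input of the algorithm for accuracy `ϵ` and confidence `1 - δ`; numbers of
trajectories and of grid points are rounded up to integers. -/
def theParams (d H : ℕ) (ϵ δ : ℝ) : Params :=
  let ε : ℝ := ϵ / (8 * H)
  let η : ℝ := ϵ / (8 * H * d)
  let L : ℕ := ⌈1 / η⌉₊
  let δ' : ℝ := δ / ((d + 3 * H * L) * (1 + H * Real.logb 2 (1 / ε)))
  { M₁ := ⌈2 * Real.log (1 / δ') * (256 * H ^ 2 * d ^ 2 / ϵ ^ 2)⌉₊
    M₂ := ⌈2 * Real.log (1 / δ') * (16 * (2 + 4 * H + 2 * H * d) ^ 2 / ϵ ^ 2)⌉₊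
    L := L
    ε := ε
    η := η }

end BallRL

end

/-! Because the actions of a state fill a ball, linearity of $Q^*$ gives
$V_h^*(s)=\langle\varphi(s),\theta_h\rangle+\rho(s)\Theta$. Playing the direction `w h` in every
state of step `h` loses exactly `gap Θ (w h) (θ h)` per unit of radius, whatever the state. So the
total loss of a greedy policy is the sum over the steps of gap times expected radius
(`meanReward_eq`).

Playing `0` costs `Θ` per unit of radius at every step, since all `θ h` have the same norm. Two
exploration policies that differ only at step `h` meet the same radii up to `h`. Hence the
difference of their rewards plus `Θ` times the difference of their later radii isolates
$c\,\theta_{h,i}$, where $c$ is the expected radius at step `h` (`explore_identity`). With a grid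
candidate in place of `Θ`, samples give an estimate of $c\,\theta_h$, of which only the direction
matters (`mul_gap_le`). Some candidate is within `η / 2` of `Θ`, unless `Θ` is so small that
directions are irrelevant.

The policy of this candidate stays good at a step until its expected radius there has roughly
doubled since the last exploration, and then the loop condition asks for a new one. When the loop
ends, each step loses at most `15 / 2 * ε` (`loss_le_of_learned`), and choosing by empirical reward
loses `ε / 2` more; together this is at most $8H\varepsilon=\epsilon$.

Recorded radii start at `ε` or more, at least double with each further exploration and never exceed
`1`, so there are about $H\log_2(1/\varepsilon)$ rounds (`ae_runLaw_halted`). Hoeffding bounds and a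
union bound over the rounds give the confidence (`runLaw_not_good_le`, `total_failure_le`). -/

noncomputable section

namespace BallRL

universe u
variable {d : ℕ} {S : ℕ → Type u} [∀ h, MeasurableSpace (S h)]

/-! ### Measures depending measurably on a parameter -/

section MeasurableMeasure

variable {X Y Z : Type*} [MeasurableSpace X] [MeasurableSpace Y] [MeasurableSpace Z]

theorem measurable_bind_param {κ : X → Measure Y} {η : X → Y → Measure Z} (hκ : Measurable κ)
    (hη : Measurable (Function.uncurry η)) [∀ x, IsProbabilityMeasure (κ x)] :
    Measurable fun x => (κ x).bind (η x) := by
  refine Measure.measurable_of_measurable_coe _ fun s hs => ?_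
  have h1 : ∀ x, Measurable (η x) := fun x => hη.comp measurable_prodMk_left
  simp_rw [fun x => Measure.bind_apply hs (h1 x).aemeasurable]
  let K : Kernel X Y := ⟨κ, hκ⟩
  have : IsMarkovKernel K := ⟨fun x => by change IsProbabilityMeasure (κ x); infer_instance⟩
  exact Measurable.lintegral_kernel_prod_right (κ := K)
    (f := fun x y => η x y s) ((Measure.measurable_coe hs).comp hη)

theorem measurable_prod_param {κ : X → Measure Y} {η : X → Measure Z} (hκ : Measurable κ)
    (hη : Measurable η) [∀ x, IsProbabilityMeasure (κ x)] [∀ x, IsProbabilityMeasure (η x)] :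
    Measurable fun x => (κ x).prod (η x) := by
  let K : Kernel X Y := ⟨κ, hκ⟩
  have : IsMarkovKernel K := ⟨fun x => by change IsProbabilityMeasure (κ x); infer_instance⟩
  let K' : Kernel X Z := ⟨η, hη⟩
  have : IsMarkovKernel K' := ⟨fun x => by change IsProbabilityMeasure (η x); infer_instance⟩
  have h : (fun x => (κ x).prod (η x)) = Kernel.prod K K' :=
    funext fun x => (Kernel.prod_apply K K' x).symm
  rw [h]
  exact Kernel.measurable _

theorem measurable_map_param {κ : X → Measure Y} {f : X → Y → Z} (hκ : Measurable κ)
    (hf : Measurable (Function.uncurry f)) [∀ x, IsProbabilityMeasure (κ x)] :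
    Measurable fun x => (κ x).map (f x) := by
  have h := measurable_bind_param (η := fun x y => Measure.dirac (f x y)) hκ
    (Measure.measurable_dirac.comp hf)
  have h1 : (fun x => (κ x).map (f x)) = fun x => (κ x).bind fun y => Measure.dirac (f x y) :=
    funext fun x => (Measure.bind_dirac_eq_map _ (hf.comp measurable_prodMk_left)).symm
  rwa [h1]

theorem isProbabilityMeasure_bind' {μ : Measure X} [IsProbabilityMeasure μ] {κ : X → Measure Y}
    (hκ : Measurable κ) (h : ∀ x, IsProbabilityMeasure (κ x)) :
    IsProbabilityMeasure (μ.bind κ) :=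
  ⟨by simp [Measure.bind_apply MeasurableSet.univ hκ.aemeasurable]⟩

theorem integral_bind' {μ : Measure X} [IsProbabilityMeasure μ] {κ : X → Measure Y}
    (hκ : Measurable κ) (h : ∀ x, IsProbabilityMeasure (κ x)) {f : Y → ℝ}
    (hf : Integrable f (μ.bind κ)) : ∫ y, f y ∂(μ.bind κ) = ∫ x, ∫ y, f y ∂(κ x) ∂μ := by
  let K : Kernel X Y := ⟨κ, hκ⟩
  have hK : IsMarkovKernel K := ⟨h⟩
  have h1 : μ.bind κ = (K ∘ₖ Kernel.const Unit μ) () := by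
    rw [Kernel.comp_apply, Kernel.const_apply]; rfl
  rw [h1] at hf ⊢
  rw [Kernel.integral_comp hf, Kernel.const_apply]
  rfl

/-- The general inequality for the mass of a set under `bind` is enough, so `κ` need not be
measurable. -/
theorem ae_bind_of_forall {μ : Measure X} {κ : X → Measure Y} {P : X → Prop} {Q : Y → Prop}
    (hQ : MeasurableSet {y | Q y}) (hP : ∀ᵐ x ∂μ, P x) (h : ∀ x, P x → ∀ᵐ y ∂(κ x), Q y) :
    ∀ᵐ y ∂(μ.bind κ), Q y := by
  rw [ae_iff]
  refine le_antisymm ((Measure.bind_apply_le κ hQ.compl).trans ?_) zero_le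
  refine le_of_eq (lintegral_eq_zero_of_ae_eq_zero ?_)
  filter_upwards [hP] with x hx using ae_iff.1 (h x hx)

end MeasurableMeasure

/-! ### The law of an observed trajectory -/

section Observation

variable (M : MDP d S)

/-- The policies that are run depend on the random memory, so measurability is needed jointly in a
parameter of the policy and the state. Total mass one is carried through the same induction because
`bind` and `prod` use it. -/
theorem measurable_obsFrom_param_aux {X : Type*} [MeasurableSpace X] (act : X → ∀ h, S h → Vec d)
    (hact : ∀ h, Measurable fun p : X × S h => act p.1 h p.2) (n : ℕ) :
    ∀ h, (Measurable fun p : X × S h => M.obsFrom (act p.1) n h p.2) ∧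
      ∀ p : X × S h, IsProbabilityMeasure (M.obsFrom (act p.1) n h p.2) := by
  induction n with
  | zero =>
    intro h
    refine ⟨?_, fun p => ?_⟩
    · simp only [MDP.obsFrom]
      exact measurable_const
    · simp only [MDP.obsFrom]
      infer_instance
  | succ n ih =>
    intro h
    have hm : Measurable fun p : X × S h => (p.2, act p.1 h p.2) :=
      measurable_snd.prodMk (hact h)
    have hr : Measurable fun p : X × S h => M.reward h (p.2, act p.1 h p.2) :=
      (M.reward h).measurable.comp hm
    have ht : Measurable fun p : X × S h => M.trans h (p.2, act p.1 h p.2) :=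
      (M.trans h).measurable.comp hm
    have hsec : ∀ x, Measurable (M.obsFrom (act x) n (h + 1)) := fun x =>
      (ih (h + 1)).1.comp measurable_prodMk_left
    have hb : Measurable fun p : X × S h =>
        (M.trans h (p.2, act p.1 h p.2)).bind (M.obsFrom (act p.1) n (h + 1)) :=
      measurable_bind_param (η := fun p : X × S h => M.obsFrom (act p.1) n (h + 1)) ht
        ((ih (h + 1)).1.comp ((measurable_fst.comp measurable_fst).prodMk measurable_snd))
    have hp : ∀ p : X × S h, IsProbabilityMeasure
        ((M.trans h (p.2, act p.1 h p.2)).bind (M.obsFrom (act p.1) n (h + 1))) := fun p =>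
      isProbabilityMeasure_bind' (hsec _) fun s => (ih (h + 1)).2 (p.1, s)
    have hf : Measurable (Function.uncurry fun (p : X × S h) (q : ℝ × Obs) =>
        ((Function.update q.2.1 h (M.radius h p.2), q.1 + q.2.2) : Obs)) := by
      refine Measurable.prodMk ?_ (by fun_prop)
      refine measurable_pi_iff.2 fun k => ?_
      rcases eq_or_ne k h with rfl | hk
      · simp only [Function.update_self]
        exact (M.radius_meas k).comp (measurable_snd.comp measurable_fst)
      · simp only [Function.update_of_ne hk]
        fun_prop
    refine ⟨?_, fun p => ?_⟩
    · simp only [MDP.obsFrom]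
      exact measurable_map_param (measurable_prod_param hr hb) hf
    · simp only [MDP.obsFrom]
      have := hp p
      exact Measure.isProbabilityMeasure_map (hf.comp measurable_prodMk_left).aemeasurable

theorem measurable_obsFrom (π : Policy M) (n h : ℕ) : Measurable (M.obsFrom π.act n h) :=
  (measurable_obsFrom_param_aux M (fun _ : Unit => π.act)
    (fun h => (π.meas h).comp measurable_snd) n h).1.comp
    (measurable_const (a := ()) |>.prodMk measurable_id)

instance (π : Policy M) (n h : ℕ) (s : S h) : IsProbabilityMeasure (M.obsFrom π.act n h s) :=
  (measurable_obsFrom_param_aux M (fun _ : Unit => π.act)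
    (fun h => (π.meas h).comp measurable_snd) n h).2 ((), s)

instance (H : ℕ) (π : Policy M) : IsProbabilityMeasure (M.obsLaw H π) :=
  isProbabilityMeasure_bind' (measurable_obsFrom M π H 0) fun _ => inferInstance

theorem measurable_obsLaw_greedy (H : ℕ) :
    Measurable fun w : ℕ → Vec d => M.obsLaw H (greedy M w) := by
  unfold MDP.obsLaw
  refine measurable_bind_param (κ := fun _ : ℕ → Vec d => M.init)
    (η := fun w => M.obsFrom (greedy M w).act H 0) measurable_const ?_
  refine (measurable_obsFrom_param_aux M (fun w : ℕ → Vec d => (greedy M w).act) (fun h => ?_) H 0).1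
  have hw : Measurable fun p : (ℕ → Vec d) × S h => p.1 h :=
    (measurable_pi_apply h).comp measurable_fst
  exact (((M.radius_meas h).comp measurable_snd).div hw.norm).smul hw

/-- The measurable map that prepends a step to an observation. -/
theorem measurable_prepend (h : ℕ) (r : ℝ) :
    Measurable fun q : ℝ × Obs => ((Function.update q.2.1 h r, q.1 + q.2.2) : Obs) := by
  refine Measurable.prodMk ?_ (by fun_prop)
  refine measurable_pi_iff.2 fun k => ?_
  rcases eq_or_ne k h with rfl | hk
  · simp
  · simp only [Function.update_of_ne hk]
    fun_prop

instance (π : Policy M) (n h : ℕ) (p : S h × Vec d) :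
    IsProbabilityMeasure ((M.trans h p).bind (M.obsFrom π.act n (h + 1))) :=
  isProbabilityMeasure_bind' (measurable_obsFrom M π n (h + 1)) fun _ => inferInstance

theorem lintegral_obsFrom_succ (π : Policy M) (n h : ℕ) (s : S h) {f : Obs → ENNReal}
    (hf : Measurable f) :
    ∫⁻ o, f o ∂(M.obsFrom π.act (n + 1) h s) =
      ∫⁻ x, ∫⁻ s', ∫⁻ o, f (Function.update o.1 h (M.radius h s), x + o.2)
        ∂(M.obsFrom π.act n (h + 1) s') ∂(M.trans h (s, π.act h s))
        ∂(M.reward h (s, π.act h s)) := by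
  have hm := measurable_prepend h (M.radius h s)
  have hg : Measurable fun q : ℝ × Obs =>
      f (Function.update q.2.1 h (M.radius h s), q.1 + q.2.2) := hf.comp hm
  rw [MDP.obsFrom, lintegral_map hf hm, lintegral_prod _ hg.aemeasurable]
  refine lintegral_congr fun x => ?_
  rw [Measure.lintegral_bind (measurable_obsFrom M π n (h + 1)).aemeasurable]
  exact (hg.comp measurable_prodMk_left).aemeasurable

/-- The law of the radius met at step `k` only depends on the actions before step `k`. -/
theorem lintegral_radius_congr (π π' : Policy M) (k : ℕ) {f : ℝ → ENNReal} (hf : Measurable f)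
    (n : ℕ) : ∀ (h : ℕ), (∀ j, h ≤ j → j < k → π.act j = π'.act j) → ∀ s : S h,
      ∫⁻ o, f (o.1 k) ∂(M.obsFrom π.act n h s) = ∫⁻ o, f (o.1 k) ∂(M.obsFrom π'.act n h s) := by
  induction n with
  | zero => intro h _ s; simp only [MDP.obsFrom]
  | succ n ih =>
    intro h hπ s
    have hf' : Measurable fun o : Obs => f (o.1 k) := by fun_prop
    rw [lintegral_obsFrom_succ M π n h s hf', lintegral_obsFrom_succ M π' n h s hf']
    rcases eq_or_ne k h with rfl | hk
    · simp
    · simp only [Function.update_of_ne hk]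
      -- For `k < h` no later step writes coordinate `k`, which keeps its default value `0`; both
      -- sides are then `f 0`.
      rcases lt_or_gt_of_ne hk with hlt | hlt
      · have hz : ∀ (π : Policy M) (n j : ℕ) (_ : k < j) (s : S j),
            ∫⁻ o, f (o.1 k) ∂(M.obsFrom π.act n j s) = f 0 := by
          intro π n
          induction n with
          | zero => intro j _ s; simp [MDP.obsFrom, lintegral_dirac' _ hf']
          | succ n ihn =>
            intro j hj s
            rw [lintegral_obsFrom_succ M π n j s hf']
            simp only [Function.update_of_ne hj.ne, ihn (j + 1) (by omega)]
            simp
        simp [hz _ n (h + 1) (by omega)]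
      · have hs := hπ h le_rfl hlt
        simp only [hs, ih (h + 1) fun j h1 h2 => hπ j (by omega) h2]

theorem lintegral_obsLaw (H : ℕ) (π : Policy M) {f : Obs → ENNReal} (hf : Measurable f) :
    ∫⁻ o, f o ∂(M.obsLaw H π) = ∫⁻ s, ∫⁻ o, f o ∂(M.obsFrom π.act H 0 s) ∂M.init := by
  rw [MDP.obsLaw, Measure.lintegral_bind (measurable_obsFrom M π H 0).aemeasurable hf.aemeasurable]

/-- Comparing the laws of the radius, rather than its integrals, makes integrability unnecessary. -/
theorem integral_radius_congr (H : ℕ) (π π' : Policy M) (k : ℕ)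
    (h : ∀ j < k, π.act j = π'.act j) :
    ∫ o, o.1 k ∂(M.obsLaw H π) = ∫ o, o.1 k ∂(M.obsLaw H π') := by
  have hk : Measurable fun o : Obs => o.1 k := by fun_prop
  have h1 : (M.obsLaw H π).map (fun o => o.1 k) = (M.obsLaw H π').map (fun o => o.1 k) := by
    refine Measure.ext_of_lintegral _ fun f hf => ?_
    have hfk : Measurable fun o : Obs => f (o.1 k) := hf.comp hk
    rw [lintegral_map hf hk, lintegral_map hf hk, lintegral_obsLaw M H π hfk,
      lintegral_obsLaw M H π' hfk]
    exact lintegral_congr fun s => lintegral_radius_congr M π π' k hf H 0 (fun j _ => h j) s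
  have h2 : ∀ μ : Measure Obs, ∫ o, o.1 k ∂μ = ∫ x, x ∂(μ.map fun o => o.1 k) := fun μ =>
    (integral_map (f := fun x : ℝ => x) hk.aemeasurable
      measurable_id.aestronglyMeasurable).symm
  rw [h2, h2, h1]

theorem ae_obsFrom_nonneg (π : Policy M) (n : ℕ) : ∀ (h : ℕ) (s : S h),
    ∀ᵐ o ∂(M.obsFrom π.act n h s), ∀ k, 0 ≤ o.1 k := by
  induction n with
  | zero =>
    intro h s
    simp only [MDP.obsFrom]
    exact (ae_dirac_iff (by measurability)).2 (by simp)
  | succ n ih =>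
    intro h s
    have hm := measurable_prepend h (M.radius h s)
    have hQ : MeasurableSet {o : Obs | ∀ k, 0 ≤ o.1 k} := by measurability
    simp only [MDP.obsFrom]
    rw [ae_map_iff hm.aemeasurable hQ]
    have h1 : ∀ᵐ o ∂((M.trans h (s, π.act h s)).bind (M.obsFrom π.act n (h + 1))),
        ∀ k, 0 ≤ o.1 k :=
      ae_bind_of_forall (P := fun _ => True) hQ (by simp) fun s' _ => ih (h + 1) s'
    have h2 := Measure.quasiMeasurePreserving_snd
      (μ := M.reward h (s, π.act h s))
      (ν := (M.trans h (s, π.act h s)).bind (M.obsFrom π.act n (h + 1))) |>.ae h1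
    filter_upwards [h2] with q hq k
    rcases eq_or_ne k h with rfl | hk
    · simpa using (M.radius_pos k s).le
    · simpa [Function.update_of_ne hk] using hq k

theorem ae_obsLaw_nonneg (H : ℕ) (π : Policy M) : ∀ᵐ o ∂(M.obsLaw H π), ∀ k, 0 ≤ o.1 k :=
  ae_bind_of_forall (P := fun _ => True) (by measurability) (by simp)
    fun s _ => ae_obsFrom_nonneg M π H 0 s

end Observation

end BallRL

end

noncomputable section

namespace BallRL

universe u
variable {d : ℕ} {S : ℕ → Type u} [∀ h, MeasurableSpace (S h)]

/-! ### Loss caused by a wrong direction -/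

section Gap

/-- The loss, per unit of radius, of playing in direction `v` where the optimal direction is `θ`
and `‖θ‖ = Θ`. -/
def gap (Θ : ℝ) (v θ : Vec d) : ℝ := Θ - inner ℝ (‖v‖⁻¹ • v) θ

theorem norm_normalize_le (v : Vec d) : ‖‖v‖⁻¹ • v‖ ≤ 1 := by
  rcases eq_or_ne (‖v‖) 0 with h | h
  · simp [h]
  · rw [norm_smul, norm_inv, norm_norm, inv_mul_cancel₀ h]

theorem abs_inner_normalize_le (v θ : Vec d) : |inner ℝ (‖v‖⁻¹ • v) θ| ≤ ‖θ‖ :=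
  (abs_real_inner_le_norm _ _).trans
    (mul_le_of_le_one_left (norm_nonneg _) (norm_normalize_le v))

theorem gap_nonneg {Θ : ℝ} {θ : Vec d} (h : ‖θ‖ = Θ) (v : Vec d) : 0 ≤ gap Θ v θ := by
  have := (abs_le.1 (abs_inner_normalize_le v θ)).2
  rw [gap]; linarith

theorem gap_le {Θ : ℝ} {θ : Vec d} (h : ‖θ‖ = Θ) (v : Vec d) : gap Θ v θ ≤ 2 * Θ := by
  have := (abs_le.1 (abs_inner_normalize_le v θ)).1
  rw [gap]; linarith

/-- The convention `0⁻¹ = 0` agrees with `greedy`, which plays `0` where the direction vanishes. -/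
theorem gap_zero (Θ : ℝ) (θ : Vec d) : gap Θ 0 θ = Θ := by simp [gap]

theorem inner_normalize_self (v : Vec d) : inner ℝ (‖v‖⁻¹ • v) v = ‖v‖ := by
  rw [real_inner_smul_left, real_inner_self_eq_norm_sq]
  rcases eq_or_ne (‖v‖) 0 with h | h
  · simp [h]
  · field_simp

theorem gap_self {Θ : ℝ} {θ : Vec d} (h : ‖θ‖ = Θ) : gap Θ θ θ = 0 := by
  rw [gap, inner_normalize_self, h, sub_self]

theorem gap_smul {Θ c : ℝ} (hc : 0 < c) (v θ : Vec d) : gap Θ (c • v) θ = gap Θ v θ := by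
  have : ‖c • v‖⁻¹ • (c • v) = ‖v‖⁻¹ • v := by
    rw [norm_smul, Real.norm_of_nonneg hc.le, smul_smul, mul_inv, mul_right_comm,
      inv_mul_cancel₀ hc.ne', one_mul]
  rw [gap, gap, this]

/-- With $v=c\theta+e$, both $\|c\theta\|-\|v\|$ and the inner product of $e$ with the normalized
$v$ are at most $\|e\|$. Small $c$ makes the direction unreliable, but the loss is weighted by the
same $c$. -/
theorem mul_gap_le {Θ c : ℝ} (hc : 0 ≤ c) {θ : Vec d} (h : ‖θ‖ = Θ) (v : Vec d) :
    c * gap Θ v θ ≤ 2 * ‖v - c • θ‖ := by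
  have h1 : c * gap Θ v θ = ‖c • θ‖ - ‖v‖ + inner ℝ (‖v‖⁻¹ • v) (v - c • θ) := by
    rw [inner_sub_right, inner_normalize_self, gap, norm_smul, Real.norm_of_nonneg hc, h,
      real_inner_smul_right]
    ring
  have h2 : ‖c • θ‖ - ‖v‖ ≤ ‖v - c • θ‖ := by
    rw [norm_sub_rev]; exact norm_sub_norm_le _ _
  have h3 := (abs_le.1 (abs_inner_normalize_le v (v - c • θ))).2
  linarith

theorem measurable_gap (Θ : ℝ) (θ : Vec d) : Measurable fun v : Vec d => gap Θ v θ := by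
  unfold gap
  fun_prop

end Gap

/-! ### The optimal value function and its Bellman equation -/

variable (M : MDP d S)

/-- The optimal value function of the linear model. -/
def MDP.optValue (H : ℕ) (θ : ℕ → Vec d) (Θ : ℝ) (h : ℕ) (s : S h) : ℝ :=
  if h < H then inner ℝ (M.center h s) (θ h) + M.radius h s * Θ else 0

variable {M} {H : ℕ} {θ : ℕ → Vec d} {Θ : ℝ}

theorem inner_greedy (w : ℕ → Vec d) (h : ℕ) (s : S h) (v : Vec d) :
    inner ℝ ((greedy M w).act h s) v = M.radius h s * inner ℝ (‖w h‖⁻¹ • w h) v := by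
  simp only [greedy, real_inner_smul_left]
  ring

theorem inner_center_greedy {h : ℕ} (hh : h < H) (w : ℕ → Vec d) (s : S h) :
    inner ℝ (M.center h s + (greedy M w).act h s) (θ h) =
      M.optValue H θ Θ h s - M.radius h s * gap Θ (w h) (θ h) := by
  rw [inner_add_left, inner_greedy, MDP.optValue, if_pos hh, gap]
  ring

/-- The continuation of `greedy M θ` dominates that of every policy, so its `Q` is an upper bound
for all of them and the least upper bound in `Assumptions.linear` is attained. -/
theorem Q_greedy_of_value (hA : Assumptions M H θ Θ) {h : ℕ} (hh : h < H)
    (hv : ∀ s, M.V H (greedy M θ) (h + 1) s = M.optValue H θ Θ (h + 1) s)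
    (hle : ∀ π s, M.V H π (h + 1) s ≤ M.optValue H θ Θ (h + 1) s) (s : S h) (a : Vec d)
    (ha : ‖a‖ ≤ M.radius h s) :
    M.Q H (greedy M θ) h s a = inner ℝ (M.center h s + a) (θ h) := by
  have hl := hA.linear h hh s a ha
  refine le_antisymm (hl.1 ⟨greedy M θ, rfl⟩) (hl.2 ?_)
  rintro _ ⟨π, rfl⟩
  refine add_le_add le_rfl (integral_mono (hA.value_int π h hh s a ha)
    (hA.value_int _ h hh s a ha) fun s' => ?_)
  rw [hv]
  exact hle π s'

theorem V_eq_Q {h : ℕ} (hh : h < H) (π : Policy M) (s : S h) :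
    M.V H π h s = M.Q H π h s (π.act h s) := by
  obtain ⟨n, hn⟩ : ∃ n, H - h = n + 1 := ⟨H - h - 1, by omega⟩
  rw [MDP.V, hn, MDP.Q, MDP.valueAux]
  have : H - (h + 1) = n := by omega
  simp only [MDP.V, this]

/-- Backward induction: `greedy M θ` maximizes the linear form over the action ball in every state,
and Cauchy–Schwarz bounds any other policy. -/
theorem V_greedy_optimal (hA : Assumptions M H θ Θ) (n : ℕ) : ∀ h, H - h = n →
    (∀ s, M.V H (greedy M θ) h s = M.optValue H θ Θ h s) ∧
      ∀ π s, M.V H π h s ≤ M.optValue H θ Θ h s := by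
  induction n with
  | zero =>
    intro h hh
    have : ¬ h < H := by omega
    simp [MDP.V, hh, MDP.valueAux, MDP.optValue, this]
  | succ n ih =>
    intro h hn
    have hh : h < H := by omega
    obtain ⟨h1, h2⟩ := ih (h + 1) (by omega)
    refine ⟨fun s => ?_, fun π s => ?_⟩
    · rw [V_eq_Q hh, Q_greedy_of_value hA hh h1 h2 _ _ ((greedy M θ).mem h s),
        inner_center_greedy hh (Θ := Θ), gap_self (hA.norm_eq h hh)]
      ring
    · rw [V_eq_Q hh]
      refine ((hA.linear h hh s _ (π.mem h s)).1 ⟨π, rfl⟩).trans ?_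
      rw [inner_add_left, MDP.optValue, if_pos hh, ← hA.norm_eq h hh]
      gcongr
      exact (real_inner_le_norm _ _).trans
        (mul_le_mul_of_nonneg_right (π.mem h s) (norm_nonneg _))

theorem Vstar_eq_optValue (hA : Assumptions M H θ Θ) (h : ℕ) (s : S h) :
    M.Vstar H h s = M.optValue H θ Θ h s := by
  obtain ⟨h1, h2⟩ := V_greedy_optimal hA _ h rfl
  have : Nonempty (Policy M) := ⟨greedy M θ⟩
  refine le_antisymm (ciSup_le fun π => h2 π s) ?_
  rw [← h1]
  exact le_ciSup (f := fun π => M.V H π h s) ⟨_, by rintro _ ⟨π, rfl⟩; exact h2 π s⟩ (greedy M θ)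

/-- A single policy attains the optimal values in all states of the next step, so its `Q` function
already is the Bellman equation. -/
theorem bellman_optValue (hA : Assumptions M H θ Θ) {h : ℕ} (hh : h < H) (s : S h) (a : Vec d)
    (ha : ‖a‖ ≤ M.radius h s) :
    Integrable (M.optValue H θ Θ (h + 1)) (M.trans h (s, a)) ∧
      M.r h s a + ∫ s', M.optValue H θ Θ (h + 1) s' ∂(M.trans h (s, a)) =
        inner ℝ (M.center h s + a) (θ h) := by
  obtain ⟨h1, h2⟩ := V_greedy_optimal hA _ (h + 1) rfl
  have h3 : M.V H (greedy M θ) (h + 1) = M.optValue H θ Θ (h + 1) := funext h1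
  rw [← h3]
  exact ⟨hA.value_int _ h hh s a ha, Q_greedy_of_value hA hh h1 h2 s a ha⟩

/-! ### Expected rewards and radii from a given state -/

section Expectation

/-- The observations of the remaining steps are bounded. -/
def BoundedFrom (H h : ℕ) (μ : Measure Obs) : Prop :=
  ∃ B, ∀ᵐ o ∂μ, |o.2| ≤ B ∧ ∀ k, h ≤ k → k < H → |o.1 k| ≤ B

theorem BoundedFrom.integrable_snd {h : ℕ} {μ : Measure Obs} [IsFiniteMeasure μ]
    (hb : BoundedFrom H h μ) : Integrable (fun o : Obs => o.2) μ := by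
  obtain ⟨B, hB⟩ := hb
  exact Integrable.of_bound (by fun_prop) B (hB.mono fun o ho => ho.1)

theorem BoundedFrom.integrable_radius {h : ℕ} {μ : Measure Obs} [IsFiniteMeasure μ]
    (hb : BoundedFrom H h μ) {k : ℕ} (hk : h ≤ k) (hkH : k < H) :
    Integrable (fun o : Obs => o.1 k) μ := by
  obtain ⟨B, hB⟩ := hb
  exact Integrable.of_bound (by fun_prop) B (hB.mono fun o ho => ho.2 k hk hkH)

theorem BoundedFrom.ae_of_bind {X : Type*} [MeasurableSpace X] {μ : Measure X} {κ : X → Measure Obs}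
    (hκ : Measurable κ) {h : ℕ} (hb : BoundedFrom H h (μ.bind κ)) :
    ∀ᵐ x ∂μ, BoundedFrom H h (κ x) := by
  obtain ⟨B, hB⟩ := hb
  exact (Measure.ae_ae_of_ae_bind hκ.aemeasurable hB).mono fun x hx => ⟨B, hx⟩

variable {n h : ℕ} {s : S h} {π : Policy M}

/-- The standing bounds concern whole trajectories, almost surely. By Fubini some value `x` of the
present reward leaves the bound `B` on the sum valid for almost every continuation, whose reward is
then at most `B + |x|` in absolute value. -/
theorem BoundedFrom.tail (hb : BoundedFrom H h (M.obsFrom π.act (n + 1) h s)) :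
    BoundedFrom H (h + 1)
      ((M.trans h (s, π.act h s)).bind (M.obsFrom π.act n (h + 1))) := by
  obtain ⟨B, hB⟩ := hb
  rw [MDP.obsFrom] at hB
  have h1 := ae_of_ae_map (measurable_prepend h (M.radius h s)).aemeasurable hB
  obtain ⟨x, hx⟩ := (Measure.ae_ae_of_ae_prod h1).exists
  refine ⟨B + |x|, ?_⟩
  filter_upwards [hx] with o ho
  refine ⟨?_, fun k hk hkH => ?_⟩
  · have := abs_sub_le (x + o.2) 0 x
    simp only [sub_zero, zero_sub, abs_neg, add_sub_cancel_left] at this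
    exact this.trans (by linarith [ho.1])
  · have := ho.2 k (by omega) hkH
    simp only [Function.update_of_ne (show k ≠ h by omega)] at this
    linarith [abs_nonneg x]

theorem integral_snd_obsFrom_succ (hA : Assumptions M H θ Θ) (hh : h < H)
    (hb : BoundedFrom H h (M.obsFrom π.act (n + 1) h s)) :
    ∫ o, o.2 ∂(M.obsFrom π.act (n + 1) h s) = M.r h s (π.act h s) +
      ∫ s', ∫ o, o.2 ∂(M.obsFrom π.act n (h + 1) s') ∂(M.trans h (s, π.act h s)) := by
  have hi := hb.tail.integrable_snd
  have hr := hA.reward_int h hh s _ (π.mem h s)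
  rw [← integral_bind' (measurable_obsFrom M π n (h + 1)) (fun _ => inferInstance) hi, MDP.obsFrom,
    integral_map (measurable_prepend h (M.radius h s)).aemeasurable (by fun_prop),
    integral_add (hr.comp_fst _) (hi.comp_snd _), integral_fun_fst (fun x : ℝ => x),
    integral_fun_snd fun o : Obs => o.2]
  simp [MDP.r]

theorem integral_radius_obsFrom_succ (hb : BoundedFrom H h (M.obsFrom π.act (n + 1) h s)) {k : ℕ}
    (hk : h < k) (hkH : k < H) :
    Integrable (fun s' => ∫ o, o.1 k ∂(M.obsFrom π.act n (h + 1) s')) (M.trans h (s, π.act h s)) ∧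
    ∫ o, o.1 k ∂(M.obsFrom π.act (n + 1) h s) =
      ∫ s', ∫ o, o.1 k ∂(M.obsFrom π.act n (h + 1) s') ∂(M.trans h (s, π.act h s)) := by
  have hi := hb.tail.integrable_radius hk hkH
  constructor
  · let K : Kernel (S (h + 1)) Obs := ⟨_, measurable_obsFrom M π n (h + 1)⟩
    have hK : IsMarkovKernel K := ⟨fun s => by
      change IsProbabilityMeasure (M.obsFrom π.act n (h + 1) s); infer_instance⟩
    exact Integrable.integral_comp (κ := M.trans h) (η := K) (by rw [Kernel.comp_apply]; exact hi)
  · rw [← integral_bind' (measurable_obsFrom M π n (h + 1)) (fun _ => inferInstance) hi, MDP.obsFrom,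
      integral_map (measurable_prepend h (M.radius h s)).aemeasurable (by fun_prop)]
    simp only [Function.update_of_ne hk.ne']
    rw [integral_fun_snd fun o : Obs => o.1 k]
    simp

theorem integral_radius_obsFrom_self :
    ∫ o, o.1 h ∂(M.obsFrom π.act (n + 1) h s) = M.radius h s := by
  rw [MDP.obsFrom,
    integral_map (measurable_prepend h (M.radius h s)).aemeasurable (by fun_prop)]
  simp

/-- Links the recursion through mean rewards to the sampled total reward. Boundedness supplies the
integrability for Fubini; it passes only to almost every successor, which suffices under the
integral. -/
theorem valueAux_eq_integral (hA : Assumptions M H θ Θ) (π : Policy M) (n : ℕ) :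
    ∀ h, h + n = H → ∀ s : S h, BoundedFrom H h (M.obsFrom π.act n h s) →
      M.valueAux π n h s = ∫ o, o.2 ∂(M.obsFrom π.act n h s) := by
  induction n with
  | zero => intro h _ s _; simp [MDP.valueAux, MDP.obsFrom]
  | succ n ih =>
    intro h hn s hb
    rw [integral_snd_obsFrom_succ hA (by omega) hb, MDP.valueAux]
    congr 1
    refine integral_congr_ae ?_
    filter_upwards [hb.tail.ae_of_bind (measurable_obsFrom M π n (h + 1))] with s' hs'
    exact ih (h + 1) (by omega) s' hs'

/-- By the Bellman equation, one step of `greedy M w` falls short of the optimal value by radius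
times gap. The gap does not depend on the state, so the shortfalls of later steps average to gap
times expected radius. -/
theorem integral_snd_greedy_aux (hA : Assumptions M H θ Θ) (w : ℕ → Vec d) (n : ℕ) :
    ∀ h, h + n = H → ∀ s : S h, BoundedFrom H h (M.obsFrom (greedy M w).act n h s) →
      ∫ o, o.2 ∂(M.obsFrom (greedy M w).act n h s) = M.optValue H θ Θ h s -
        ∑ k ∈ Finset.Ico h H, gap Θ (w k) (θ k) * ∫ o, o.1 k ∂(M.obsFrom (greedy M w).act n h s) := by
  induction n with
  | zero =>
    intro h hn s _
    obtain rfl : h = H := by omega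
    simp [MDP.obsFrom, MDP.optValue]
  | succ n ih =>
    intro h hn s hb
    have hh : h < H := by omega
    obtain ⟨hi, hB⟩ := bellman_optValue hA hh s _ ((greedy M w).mem h s)
    have h1 : ∫ s', ∫ o, o.2 ∂(M.obsFrom (greedy M w).act n (h + 1) s')
          ∂(M.trans h (s, (greedy M w).act h s)) =
        ∫ s', M.optValue H θ Θ (h + 1) s' - ∑ k ∈ Finset.Ico (h + 1) H, gap Θ (w k) (θ k) *
          ∫ o, o.1 k ∂(M.obsFrom (greedy M w).act n (h + 1) s')
          ∂(M.trans h (s, (greedy M w).act h s)) := by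
      refine integral_congr_ae ?_
      filter_upwards [hb.tail.ae_of_bind (measurable_obsFrom M _ n (h + 1))] with s' hs'
      exact ih (h + 1) (by omega) s' hs'
    have h2 : ∀ k ∈ Finset.Ico (h + 1) H, Integrable (fun s' => gap Θ (w k) (θ k) *
        ∫ o, o.1 k ∂(M.obsFrom (greedy M w).act n (h + 1) s'))
        (M.trans h (s, (greedy M w).act h s)) := fun k hk => by
      rw [Finset.mem_Ico] at hk
      exact (integral_radius_obsFrom_succ hb (by omega) hk.2).1.const_mul _
    rw [integral_snd_obsFrom_succ hA hh hb, h1, integral_sub hi (integrable_finsetSum _ h2),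
      integral_finsetSum _ h2, add_sub, hB, inner_center_greedy hh (Θ := Θ),
      Finset.sum_eq_sum_Ico_succ_bot hh, integral_radius_obsFrom_self, sub_sub,
      mul_comm (M.radius h s)]
    congr 2
    refine Finset.sum_congr rfl fun k hk => ?_
    rw [Finset.mem_Ico] at hk
    rw [integral_const_mul, (integral_radius_obsFrom_succ hb (by omega) hk.2).2]

end Expectation

/-! ### Expectations over whole trajectories -/

section Law

variable (M H) in
/-- Expected total reward of the policy that is greedy for `w`. -/
def meanReward (w : ℕ → Vec d) : ℝ := ∫ o, o.2 ∂(M.obsLaw H (greedy M w))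

variable (M H) in
/-- Expected radius at step `k` under the policy that is greedy for `w`. -/
def meanRadius (w : ℕ → Vec d) (k : ℕ) : ℝ := ∫ o, o.1 k ∂(M.obsLaw H (greedy M w))

theorem ae_obsLaw_bounds (hA : Assumptions M H θ Θ) (π : Policy M) :
    ∀ᵐ o ∂(M.obsLaw H π), (0 ≤ o.2 ∧ o.2 ≤ 1) ∧ (∀ k, 0 ≤ o.1 k) ∧
      ∑ k ∈ Finset.range H, o.1 k ≤ 1 := by
  filter_upwards [hA.total π, ae_obsLaw_nonneg M H π] with o h1 h2
  exact ⟨h1.1, h2, h1.2.2⟩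

theorem ae_obsLaw_radius_le (hA : Assumptions M H θ Θ) (π : Policy M) :
    ∀ᵐ o ∂(M.obsLaw H π), ∀ k < H, o.1 k ∈ Set.Icc (0 : ℝ) 1 := by
  filter_upwards [ae_obsLaw_bounds hA π] with o ho k hk
  exact ⟨ho.2.1 k, (Finset.single_le_sum (fun i _ => ho.2.1 i) (Finset.mem_range.2 hk)).trans ho.2.2⟩

theorem ae_obsLaw_laterRadii (hA : Assumptions M H θ Θ) (π : Policy M) :
    ∀ᵐ o ∂(M.obsLaw H π), laterRadii H o ∈ Set.Icc (0 : ℝ) 1 := by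
  filter_upwards [ae_obsLaw_bounds hA π] with o ho
  refine ⟨Finset.sum_nonneg fun i _ => ho.2.1 i, le_trans ?_ ho.2.2⟩
  rw [laterRadii, Finset.range_eq_Ico]
  exact Finset.sum_le_sum_of_subset_of_nonneg (Finset.Ico_subset_Ico (by omega) le_rfl)
    fun i _ _ => ho.2.1 i

theorem boundedFrom_obsLaw (hA : Assumptions M H θ Θ) (π : Policy M) :
    BoundedFrom H 0 (M.obsLaw H π) := by
  refine ⟨1, ?_⟩
  filter_upwards [ae_obsLaw_bounds hA π, ae_obsLaw_radius_le hA π] with o h1 h2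
  refine ⟨by rw [abs_of_nonneg h1.1.1]; exact h1.1.2, fun k _ hk => ?_⟩
  rw [abs_of_nonneg (h2 k hk).1]
  exact (h2 k hk).2

theorem integral_V (hA : Assumptions M H θ Θ) (π : Policy M) :
    ∫ s, M.V H π 0 s ∂M.init = ∫ o, o.2 ∂(M.obsLaw H π) := by
  have hb := boundedFrom_obsLaw hA π
  have hm := measurable_obsFrom M π H 0
  rw [MDP.obsLaw, integral_bind' hm (fun _ => inferInstance) hb.integrable_snd]
  refine integral_congr_ae ?_
  filter_upwards [hb.ae_of_bind hm] with s hs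
  exact valueAux_eq_integral hA π H 0 (by omega) s hs

/-- The optimal value is the inner product of `θ 0` with the feature of the optimal action, hence
bounded by `Θ`. -/
theorem integrable_optValue (hA : Assumptions M H θ Θ) (hH : 0 < H) :
    Integrable (M.optValue H θ Θ 0) M.init := by
  have hm : Measurable (M.optValue H θ Θ 0) := by
    have h1 := M.center_meas 0
    have h2 := M.radius_meas 0
    have : M.optValue H θ Θ 0 = fun s => inner ℝ (M.center 0 s) (θ 0) + M.radius 0 s * Θ :=
      funext fun s => if_pos hH
    rw [this]
    fun_prop
  refine Integrable.of_bound hm.aestronglyMeasurable (1 * Θ) (Filter.Eventually.of_forall fun s => ?_)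
  have h := inner_center_greedy hH (M := M) (θ := θ) (Θ := Θ) θ s
  rw [gap_self (hA.norm_eq 0 hH), mul_zero, sub_zero] at h
  rw [← h, Real.norm_eq_abs, ← hA.norm_eq 0 hH]
  exact (abs_real_inner_le_norm _ _).trans (mul_le_mul_of_nonneg_right
    (hA.feature_le 0 hH s _ ((greedy M θ).mem 0 s)) (norm_nonneg _))

theorem meanReward_eq (hA : Assumptions M H θ Θ) (hH : 0 < H) (w : ℕ → Vec d) :
    meanReward M H w = ∫ s, M.Vstar H 0 s ∂M.init -
      ∑ k ∈ Finset.range H, gap Θ (w k) (θ k) * meanRadius M H w k := by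
  have hb := boundedFrom_obsLaw hA (greedy M w)
  have hm := measurable_obsFrom M (greedy M w) H 0
  have hr : ∀ k < H, Integrable (fun s => ∫ o, o.1 k ∂(M.obsFrom (greedy M w).act H 0 s)) M.init ∧
      meanRadius M H w k = ∫ s, ∫ o, o.1 k ∂(M.obsFrom (greedy M w).act H 0 s) ∂M.init := by
    intro k hk
    have hi := hb.integrable_radius (Nat.zero_le k) hk
    refine ⟨?_, integral_bind' hm (fun _ => inferInstance) hi⟩
    let K : Kernel (S 0) Obs := ⟨_, hm⟩
    have hK : IsMarkovKernel K := ⟨fun s => by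
      change IsProbabilityMeasure (M.obsFrom (greedy M w).act H 0 s); infer_instance⟩
    refine Integrable.integral_comp (κ := Kernel.const Unit M.init) (η := K) (a := ()) ?_
    rw [Kernel.comp_apply]
    exact hi
  have h2 : ∀ k ∈ Finset.range H, Integrable (fun s => gap Θ (w k) (θ k) *
      ∫ o, o.1 k ∂(M.obsFrom (greedy M w).act H 0 s)) M.init := fun k hk =>
    (hr k (Finset.mem_range.1 hk)).1.const_mul _
  have h3 : ∑ k ∈ Finset.range H, gap Θ (w k) (θ k) * meanRadius M H w k =
      ∑ k ∈ Finset.range H, ∫ s, gap Θ (w k) (θ k) *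
        ∫ o, o.1 k ∂(M.obsFrom (greedy M w).act H 0 s) ∂M.init :=
    Finset.sum_congr rfl fun k hk => by
      rw [(hr k (Finset.mem_range.1 hk)).2, integral_const_mul]
  simp only [Vstar_eq_optValue hA]
  rw [h3, ← integral_finsetSum _ h2, ← integral_sub (integrable_optValue hA hH)
    (integrable_finsetSum _ h2), meanReward, MDP.obsLaw,
    integral_bind' hm (fun _ => inferInstance) hb.integrable_snd]
  refine integral_congr_ae ?_
  filter_upwards [hb.ae_of_bind hm] with s hs
  rw [integral_snd_greedy_aux hA w H 0 (by omega) s hs, Finset.range_eq_Ico]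

theorem meanReward_mem (hA : Assumptions M H θ Θ) (w : ℕ → Vec d) :
    meanReward M H w ∈ Set.Icc (0 : ℝ) 1 := by
  have hb := (boundedFrom_obsLaw hA (greedy M w)).integrable_snd
  have h := ae_obsLaw_bounds hA (greedy M w)
  refine ⟨integral_nonneg_of_ae (h.mono fun o ho => ho.1.1), ?_⟩
  have := integral_mono_ae hb (integrable_const 1) (h.mono fun o ho => ho.1.2)
  simpa [meanReward] using this

theorem meanRadius_nonneg (w : ℕ → Vec d) (k : ℕ) : 0 ≤ meanRadius M H w k :=
  integral_nonneg_of_ae ((ae_obsLaw_nonneg M H _).mono fun _ ho => ho k)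

theorem sum_meanRadius (hA : Assumptions M H θ Θ) (w : ℕ → Vec d) :
    ∑ k ∈ Finset.range H, meanRadius M H w k ≤ 1 := by
  have hb := boundedFrom_obsLaw hA (greedy M w)
  have hi : ∀ k ∈ Finset.range H, Integrable (fun o : Obs => o.1 k) (M.obsLaw H (greedy M w)) :=
    fun k hk => hb.integrable_radius (Nat.zero_le k) (Finset.mem_range.1 hk)
  have h1 := integral_mono_ae (integrable_finsetSum _ hi) (integrable_const 1)
    ((ae_obsLaw_bounds hA (greedy M w)).mono fun o ho => ho.2.2)
  rw [integral_finsetSum _ hi] at h1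
  simpa [meanRadius] using h1

theorem integral_laterRadii (hA : Assumptions M H θ Θ) (w : ℕ → Vec d) :
    ∫ o, laterRadii H o ∂(M.obsLaw H (greedy M w)) =
      ∑ k ∈ Finset.Ico 1 H, meanRadius M H w k :=
  integral_finsetSum _ fun _ hk =>
    (boundedFrom_obsLaw hA (greedy M w)).integrable_radius (Nat.zero_le _) (Finset.mem_Ico.1 hk).2

theorem measurable_laterRadii (H : ℕ) : Measurable (laterRadii H) := by
  unfold laterRadii
  fun_prop

theorem meanRadius_congr {w w' : ℕ → Vec d} {k : ℕ} (h : ∀ j < k, w j = w' j) :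
    meanRadius M H w k = meanRadius M H w' k :=
  integral_radius_congr M H _ _ k fun j hj => by simp [greedy, h j hj]

variable (M H) in
theorem measurable_meanRadius (k : ℕ) : Measurable fun w => meanRadius M H w k := by
  let K : Kernel (ℕ → Vec d) Obs := ⟨_, measurable_obsLaw_greedy M H⟩
  have hK : IsMarkovKernel K := ⟨fun w => by
    change IsProbabilityMeasure (M.obsLaw H (greedy M w)); infer_instance⟩
  exact (StronglyMeasurable.integral_kernel (κ := K) (f := fun o : Obs => o.1 k)
    (Measurable.stronglyMeasurable (by fun_prop))).measurable

variable (M H) in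
theorem measurable_meanReward : Measurable fun w => meanReward M H w := by
  let K : Kernel (ℕ → Vec d) Obs := ⟨_, measurable_obsLaw_greedy M H⟩
  have hK : IsMarkovKernel K := ⟨fun w => by
    change IsProbabilityMeasure (M.obsLaw H (greedy M w)); infer_instance⟩
  exact (StronglyMeasurable.integral_kernel (κ := K) (f := fun o : Obs => o.2)
    (Measurable.stronglyMeasurable (by fun_prop))).measurable

/-- The difference between the expected rewards of two policies that agree before step `h` and do
not move afterwards, in terms of the differences of the expected radii. -/
theorem explore_identity (hA : Assumptions M H θ Θ) (hH : 0 < H) {h : ℕ} (hh : h < H)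
    {w w' : ℕ → Vec d} (hlt : ∀ j < h, w j = w' j) (hgt : ∀ j, h < j → w j = 0 ∧ w' j = 0) :
    (meanReward M H w - meanReward M H w') +
        Θ * (∑ k ∈ Finset.Ico 1 H, meanRadius M H w k - ∑ k ∈ Finset.Ico 1 H, meanRadius M H w' k) =
      (gap Θ (w' h) (θ h) - gap Θ (w h) (θ h)) * meanRadius M H w h := by
  have hr : ∀ k ≤ h, meanRadius M H w k = meanRadius M H w' k := fun k hk =>
    meanRadius_congr fun j hj => hlt j (by omega)
  have h0 : ∀ w, ∑ k ∈ Finset.range H, meanRadius M H w k =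
      meanRadius M H w 0 + ∑ k ∈ Finset.Ico 1 H, meanRadius M H w k := fun w => by
    rw [Finset.range_eq_Ico, Finset.sum_eq_sum_Ico_succ_bot hH]
  -- The first radius has the same law under all policies, so including it in both sums changes
  -- nothing.
  have h1 : ∑ k ∈ Finset.Ico 1 H, meanRadius M H w k - ∑ k ∈ Finset.Ico 1 H, meanRadius M H w' k =
      ∑ k ∈ Finset.range H, (meanRadius M H w k - meanRadius M H w' k) := by
    rw [Finset.sum_sub_distrib, h0, h0, hr 0 (Nat.zero_le _)]
    ring
  rw [meanReward_eq hA hH, meanReward_eq hA hH, h1, Finset.mul_sum, sub_sub_sub_cancel_left,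
    ← Finset.sum_sub_distrib, ← Finset.sum_add_distrib,
    Finset.sum_eq_single_of_mem h (Finset.mem_range.2 hh)]
  · rw [hr h le_rfl]
    ring
  · intro k _ hk
    rcases lt_or_gt_of_ne hk with hlt' | hgt'
    · rw [hr k hlt'.le, hlt k hlt']
      ring
    -- Both policies play `0` here and lose `Θ` per unit of radius, which the correction by `Θ`
    -- times the radii cancels. This is where the common norm is essential.
    · rw [(hgt k hgt').1, (hgt k hgt').2, gap_zero]
      ring

end Law

end BallRL

end

noncomputable section

namespace BallRL

universe u
variable {d : ℕ} {S : ℕ → Type u} [∀ h, MeasurableSpace (S h)]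

/-! ### Hoeffding bounds for averages -/

section Concentration

theorem measurable_pi_param {X ι : Type*} [Fintype ι] {Y : ι → Type*} [MeasurableSpace X]
    [∀ i, MeasurableSpace (Y i)] {κ : X → ∀ i, Measure (Y i)}
    (hκ : ∀ i, Measurable fun x => κ x i) [∀ x i, IsProbabilityMeasure (κ x i)] :
    Measurable fun x => Measure.pi (κ x) := by
  refine Measurable.measure_of_isPiSystem_of_isProbabilityMeasure generateFrom_pi.symm
    isPiSystem_pi ?_
  rintro _ ⟨t, ht, rfl⟩
  simp only [Measure.pi_pi]
  exact Finset.measurable_prod _ fun i _ => (Measure.measurable_coe (ht i trivial)).comp (hκ i)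

theorem ae_pi_eval {ι : Type*} [Fintype ι] {Y : ι → Type*} [∀ i, MeasurableSpace (Y i)]
    (μ : ∀ i, Measure (Y i)) [∀ i, IsProbabilityMeasure (μ i)] {P : ∀ i, Y i → Prop}
    (h : ∀ i, ∀ᵐ y ∂(μ i), P i y) : ∀ᵐ o ∂(Measure.pi μ), ∀ i, P i (o i) :=
  ae_all_iff.2 fun i => (Measure.quasiMeasurePreserving_eval μ i).ae (h i)

variable {X : Type*} [MeasurableSpace X]

theorem measurable_avg {m : ℕ} {f : X → ℝ} (hf : Measurable f) :
    Measurable fun o : Fin m → X => avg f o := by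
  unfold avg
  fun_prop

omit [MeasurableSpace X] in
theorem avg_mem_Icc {m : ℕ} {f : X → ℝ} {o : Fin m → X} (h : ∀ j, f (o j) ∈ Set.Icc (0 : ℝ) 1) :
    avg f o ∈ Set.Icc (0 : ℝ) 1 := by
  refine ⟨div_nonneg (Finset.sum_nonneg fun j _ => (h j).1) (Nat.cast_nonneg _), ?_⟩
  refine div_le_one_of_le₀ ?_ (Nat.cast_nonneg _)
  simpa using Finset.sum_le_sum fun j (_ : j ∈ Finset.univ) => (h j).2

/-- The average of an independent sample of size `m` with values in `[0, B]` is sub-Gaussian with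
parameter `B ^ 2 / (4 * m)`. -/
theorem hasSubgaussianMGF_avg (μ : Measure X) [IsProbabilityMeasure μ] {f : X → ℝ}
    (hf : Measurable f) {B : ℝ} (hb : ∀ᵐ x ∂μ, f x ∈ Set.Icc (0 : ℝ) B) {m : ℕ} (hm : 0 < m) :
    HasSubgaussianMGF (fun o : Fin m → X => avg f o - ∫ x, f x ∂μ) (B ^ 2 / (4 * m)).toNNReal
      (Measure.pi fun _ => μ) := by
  have h1 : ∀ j : Fin m, HasSubgaussianMGF (fun o : Fin m → X => f (o j) - ∫ x, f x ∂μ)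
      ((‖B - 0‖₊ / 2) ^ 2) (Measure.pi fun _ => μ) := fun j => by
    have h2 := hasSubgaussianMGF_of_mem_Icc hf.aemeasurable hb
    have h3 : (Measure.pi fun _ : Fin m => μ).map (Function.eval j) = μ :=
      (measurePreserving_eval (fun _ : Fin m => μ) j).map_eq
    rw [← h3] at h2
    have h4 := HasSubgaussianMGF.of_map (μ := Measure.pi fun _ : Fin m => μ)
      (Y := Function.eval j) (measurable_pi_apply j).aemeasurable h2
    rwa [h3] at h4
  have h2 : iIndepFun (fun j (o : Fin m → X) => f (o j) - ∫ x, f x ∂μ)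
      (Measure.pi fun _ => μ) :=
    iIndepFun_pi (X := fun _ x => f x - ∫ x, f x ∂μ) fun _ => (hf.sub_const _).aemeasurable
  have h3 := (HasSubgaussianMGF.sum_of_iIndepFun h2 (s := Finset.univ) fun j _ => h1 j).const_mul
    (m : ℝ)⁻¹
  have hm' : (m : ℝ) ≠ 0 := by positivity
  convert h3 using 1
  · ext o
    rw [Finset.sum_sub_distrib, avg]
    simp
    field_simp
  · ext
    rw [Real.coe_toNNReal _ (by positivity)]
    change B ^ 2 / (4 * m) = (m : ℝ)⁻¹ ^ 2 * ((∑ _j : Fin m, (‖B - 0‖₊ / 2) ^ 2 : NNReal) : ℝ)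
    simp
    field_simp
    rw [sq_abs]
    ring

theorem measure_abs_ge_le_of_subgaussian {μ : Measure X} [IsFiniteMeasure μ] {Y : X → ℝ}
    {c : NNReal} (h : HasSubgaussianMGF Y c μ) {t : ℝ} (ht : 0 ≤ t) :
    μ {x | t ≤ |Y x|} ≤ ENNReal.ofReal (2 * Real.exp (-t ^ 2 / (2 * c))) := by
  have h1 : {x | t ≤ |Y x|} ⊆ {x | t ≤ Y x} ∪ {x | t ≤ (-Y) x} := fun x hx => by
    rcases le_abs.1 (show t ≤ |Y x| from hx) with h | h
    · exact Or.inl h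
    · exact Or.inr h
  have h2 := h.measure_ge_le ht
  have h3 := h.neg.measure_ge_le ht
  refine (measure_mono h1).trans ((measure_union_le _ _).trans ?_)
  rw [two_mul, ENNReal.ofReal_add (Real.exp_nonneg _) (Real.exp_nonneg _)]
  exact add_le_add ((ENNReal.le_ofReal_iff_toReal_le (measure_ne_top _ _) (Real.exp_nonneg _)).2 h2)
    ((ENNReal.le_ofReal_iff_toReal_le (measure_ne_top _ _) (Real.exp_nonneg _)).2 h3)

/-- Samples of different policies are independent, so the two sub-Gaussian parameters add. -/
theorem hasSubgaussianMGF_avg_sub {ι : Type*} [Fintype ι] (μ : ι → Measure X)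
    [∀ i, IsProbabilityMeasure (μ i)] {f : X → ℝ} (hf : Measurable f) {B : ℝ}
    (hb : ∀ i, ∀ᵐ x ∂(μ i), f x ∈ Set.Icc (0 : ℝ) B) {m : ℕ} (hm : 0 < m) {i j : ι} (hij : i ≠ j) :
    HasSubgaussianMGF (fun o : ι → Fin m → X =>
        avg f (o i) - avg f (o j) - (∫ x, f x ∂(μ i) - ∫ x, f x ∂(μ j)))
      (B ^ 2 / (2 * m)).toNNReal (Measure.pi fun i => Measure.pi fun _ => μ i) := by
  let g : ι → (Fin m → X) → ℝ := fun i o => avg f o - ∫ x, f x ∂(μ i)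
  have hg : ∀ i, Measurable (g i) := fun i => (measurable_avg hf).sub_const _
  have h1 : ∀ i, HasSubgaussianMGF (fun o : ι → Fin m → X => g i (o i))
      (B ^ 2 / (4 * m)).toNNReal (Measure.pi fun i => Measure.pi fun _ => μ i) := fun i => by
    have h2 := hasSubgaussianMGF_avg (μ i) hf (hb i) hm
    have h3 := (measurePreserving_eval (fun i => Measure.pi fun _ : Fin m => μ i) i).map_eq
    rw [← h3] at h2
    exact HasSubgaussianMGF.of_map
      (μ := Measure.pi fun i => Measure.pi fun _ : Fin m => μ i)
      (Y := Function.eval i) (measurable_pi_apply i).aemeasurable h2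
  have h2 : iIndepFun (fun i (o : ι → Fin m → X) => g i (o i))
      (Measure.pi fun i => Measure.pi fun _ => μ i) :=
    iIndepFun_pi fun i => (hg i).aemeasurable
  have h3 := (h1 i).sub_of_indepFun (h1 j) (h2.indepFun hij)
  have hm' : (m : ℝ) ≠ 0 := by positivity
  convert h3 using 1
  · ext o
    simp only [g]
    ring
  · rw [← Real.toNNReal_add (by positivity) (by positivity)]
    congr 1
    field_simp
    ring

end Concentration

variable {H L : ℕ}

/-! ### Measurability of the updates of the memory -/

section MeasurableState

theorem AlgState.measurable_toProd : Measurable (AlgState.toProd (d := d) (H := H) (L := L)) :=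
  comap_measurable _

theorem AlgState.measurable_rad (h : Fin H) : Measurable fun x : AlgState d H L => x.rad h :=
  (measurable_pi_apply h).comp (measurable_fst.comp AlgState.measurable_toProd)

theorem AlgState.measurable_radEst (h : Fin H) (l : Fin L) :
    Measurable fun x : AlgState d H L => x.radEst h l :=
  (measurable_pi_apply l).comp ((measurable_pi_apply h).comp
    (measurable_fst.comp (measurable_snd.comp AlgState.measurable_toProd)))

theorem AlgState.measurable_est (h : Fin H) (l : Fin L) :
    Measurable fun x : AlgState d H L => x.est h l :=
  (measurable_pi_apply l).comp ((measurable_pi_apply h).comp (measurable_fst.comp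
    (measurable_snd.comp (measurable_snd.comp AlgState.measurable_toProd))))

theorem AlgState.measurable_best : Measurable fun x : AlgState d H L => x.best :=
  measurable_fst.comp (measurable_snd.comp (measurable_snd.comp
    (measurable_snd.comp AlgState.measurable_toProd)))

theorem AlgState.measurable_used : Measurable fun x : AlgState d H L => x.used :=
  measurable_snd.comp (measurable_snd.comp (measurable_snd.comp
    (measurable_snd.comp AlgState.measurable_toProd)))

theorem AlgState.measurable_of_components {X : Type*} [MeasurableSpace X] {f : X → AlgState d H L}
    (h1 : ∀ h, Measurable fun x => (f x).rad h) (h2 : ∀ h l, Measurable fun x => (f x).radEst h l)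
    (h3 : ∀ h l, Measurable fun x => (f x).est h l) (h4 : Measurable fun x => (f x).best)
    (h5 : Measurable fun x => (f x).used) : Measurable f := by
  rw [measurable_comap_iff]
  exact (measurable_pi_iff.2 h1).prodMk ((measurable_pi_iff.2 fun h => measurable_pi_iff.2 (h2 h)).prodMk
    ((measurable_pi_iff.2 fun h => measurable_pi_iff.2 (h3 h)).prodMk (h4.prodMk h5)))

theorem AlgState.measurable_dir (l : Fin L) : Measurable fun x : AlgState d H L => x.dir l := by
  refine measurable_pi_iff.2 fun h => ?_
  by_cases hh : h < H
  · simp only [AlgState.dir, hh, dif_pos]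
    exact AlgState.measurable_est _ _
  · simp [AlgState.dir, hh]

/-- The directions played by an exploration policy. -/
def AlgState.exploreDir (x : AlgState d H L) (h : Fin H) (l : Fin L) (i : Option (Fin d)) :
    ℕ → Vec d := fun h' =>
  if h' < h then x.dir l h'
  else if h' = h then i.elim 0 fun i => EuclideanSpace.single i (1 : ℝ)
  else 0

theorem AlgState.measurable_exploreDir (h : Fin H) (l : Fin L) (i : Option (Fin d)) :
    Measurable fun x : AlgState d H L => x.exploreDir h l i := by
  refine measurable_pi_iff.2 fun h' => ?_
  unfold AlgState.exploreDir
  split_ifs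
  · exact measurable_pi_iff.1 (AlgState.measurable_dir l) h'
  · exact measurable_const
  · exact measurable_const

variable {m : ℕ}

theorem AlgState.measurable_learn (η : ℝ) (p : Fin H × Fin L) :
    Measurable fun y : AlgState d H L × (Option (Fin d) → Fin m → Obs) => y.1.learn η p y.2 := by
  refine AlgState.measurable_of_components (fun h => ?_) (fun h l => ?_) (fun h l => ?_) ?_ ?_
  · rcases eq_or_ne h p.1 with rfl | hne
    · simp only [AlgState.learn, Function.update_self]
      exact (AlgState.measurable_radEst _ _).comp measurable_fst
    · simp only [AlgState.learn, Function.update_of_ne hne]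
      exact (AlgState.measurable_rad _).comp measurable_fst
  · change Measurable fun y : AlgState d H L × (Option (Fin d) → Fin m → Obs) => y.1.radEst h l
    exact (AlgState.measurable_radEst _ _).comp measurable_fst
  · rcases eq_or_ne h p.1 with rfl | hne
    · simp only [AlgState.learn, Function.update_self]
      refine (WithLp.measurable_toLp 2 _).comp (measurable_pi_iff.2 fun i => ?_)
      have h1 : ∀ i (f : Obs → ℝ), Measurable f → Measurable
          fun y : AlgState d H L × (Option (Fin d) → Fin m → Obs) => avg f (y.2 i) :=
        fun i f hf => (measurable_avg hf).comp ((measurable_pi_apply i).comp measurable_snd)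
      have h2 := fun i => h1 i _ (measurable_laterRadii H)
      have h3 := fun i => h1 i Prod.snd measurable_snd
      exact (((((h2 _).sub (h2 _)).mul_const _).add (h3 _)).sub (h3 _)).div
        ((AlgState.measurable_radEst _ _).comp measurable_fst)
    · simp only [AlgState.learn, Function.update_of_ne hne]
      exact (AlgState.measurable_est _ _).comp measurable_fst
  · change Measurable fun y : AlgState d H L × (Option (Fin d) → Fin m → Obs) => y.1.best
    exact AlgState.measurable_best.comp measurable_fst
  · exact (AlgState.measurable_used.comp measurable_fst).add_const _

theorem AlgState.measurable_assess {best : (Fin L → ℝ) → Fin L} (hb : Measurable best) :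
    Measurable fun y : AlgState d H L × (Fin L → Fin m → Obs) => y.1.assess best y.2 := by
  refine AlgState.measurable_of_components (fun h => ?_) (fun h l => ?_) (fun h l => ?_) ?_ ?_
  · change Measurable fun y : AlgState d H L × (Fin L → Fin m → Obs) => y.1.rad h
    exact (AlgState.measurable_rad _).comp measurable_fst
  · exact (measurable_avg (f := fun ω : Obs => ω.1 h) (by fun_prop)).comp
      ((measurable_pi_apply l).comp measurable_snd)
  · change Measurable fun y : AlgState d H L × (Fin L → Fin m → Obs) => y.1.est h l
    exact (AlgState.measurable_est _ _).comp measurable_fst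
  · exact hb.comp (measurable_pi_iff.2 fun l => (measurable_avg measurable_snd).comp
      ((measurable_pi_apply l).comp measurable_snd))
  · exact (AlgState.measurable_used.comp measurable_fst).add_const _

theorem measurableSet_halted (ε : ℝ) : MeasurableSet {x : AlgState d H L | Halted ε x} := by
  have h1 := AlgState.measurable_rad (d := d) (H := H) (L := L)
  have h2 := AlgState.measurable_radEst (d := d) (H := H) (L := L)
  have : {x : AlgState d H L | Halted ε x} =
      ⋂ p : Fin H × Fin L, ({x | 2 * x.rad p.1 ≤ x.radEst p.1 p.2} ∩ {x | ε ≤ x.radEst p.1 p.2})ᶜ := by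
    ext x
    simp [Halted, Admissible]
  rw [this]
  exact MeasurableSet.iInter fun p => ((measurableSet_le ((h1 _).const_mul _) (h2 _ _)).inter
    (measurableSet_le measurable_const (h2 _ _))).compl

end MeasurableState

/-! ### A round as a Markov kernel on memories -/

section MeasurableRound

variable (M : MDP d S) (H) (q : Params) {best : (Fin q.L → ℝ) → Fin q.L}
  {pick : AlgState d H q.L → Fin H × Fin q.L}

/-- Law of the samples collected in the exploration part of a round. -/
def exploreLaw (p : Fin H × Fin q.L) (x : AlgState d H q.L) :
    Measure (Option (Fin d) → Fin q.M₁ → Obs) :=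
  Measure.pi fun i => Measure.pi fun _ => M.obsLaw H (greedy M (x.exploreDir p.1 p.2 i))

/-- Law of the samples collected from the policies `π_l'`. -/
def assessLaw (x : AlgState d H q.L) : Measure (Fin q.L → Fin q.M₂ → Obs) :=
  Measure.pi fun l => Measure.pi fun _ => M.obsLaw H (greedy M (x.dir l))

instance (p : Fin H × Fin q.L) (x : AlgState d H q.L) :
    IsProbabilityMeasure (exploreLaw H M q p x) := by
  unfold exploreLaw; infer_instance

instance (x : AlgState d H q.L) : IsProbabilityMeasure (assessLaw H M q x) := by
  unfold assessLaw; infer_instance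

theorem bodyLaw_eq (best : (Fin q.L → ℝ) → Fin q.L) (p : Fin H × Fin q.L) (x : AlgState d H q.L) :
    bodyLaw M H q best p x = (exploreLaw H M q p x).bind fun o =>
      (assessLaw H M q (x.learn q.η p o)).map fun o' => (x.learn q.η p o).assess best o' := rfl

theorem measurable_exploreLaw (p : Fin H × Fin q.L) : Measurable (exploreLaw H M q p) :=
  measurable_pi_param fun i => measurable_pi_param fun _ =>
    (measurable_obsLaw_greedy M H).comp (AlgState.measurable_exploreDir p.1 p.2 i)

theorem measurable_assessLaw : Measurable (assessLaw H M q) :=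
  measurable_pi_param fun l => measurable_pi_param fun _ =>
    (measurable_obsLaw_greedy M H).comp (AlgState.measurable_dir l)

theorem measurable_learn_assessLaw (hb : Measurable best) (p : Fin H × Fin q.L) :
    Measurable (Function.uncurry fun (x : AlgState d H q.L) (o : Option (Fin d) → Fin q.M₁ → Obs) =>
      (assessLaw H M q (x.learn q.η p o)).map fun o' => (x.learn q.η p o).assess best o') := by
  have h1 := AlgState.measurable_learn (d := d) (m := q.M₁) q.η p
  exact measurable_map_param
    (κ := fun y : AlgState d H q.L × (Option (Fin d) → Fin q.M₁ → Obs) =>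
      assessLaw H M q (y.1.learn q.η p y.2))
    (f := fun y o' => (y.1.learn q.η p y.2).assess best o')
    ((measurable_assessLaw H M q).comp h1)
    ((AlgState.measurable_assess hb).comp ((h1.comp measurable_fst).prodMk measurable_snd))

theorem measurable_bodyLaw (hb : Measurable best) (p : Fin H × Fin q.L) :
    Measurable (bodyLaw M H q best p) :=
  measurable_bind_param (measurable_exploreLaw H M q p) (measurable_learn_assessLaw H M q hb p)

theorem isProbabilityMeasure_bodyLaw (hb : Measurable best) (p : Fin H × Fin q.L)
    (x : AlgState d H q.L) : IsProbabilityMeasure (bodyLaw M H q best p x) := by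
  rw [bodyLaw_eq]
  exact isProbabilityMeasure_bind'
    ((measurable_learn_assessLaw H M q hb p).comp measurable_prodMk_left) fun o =>
      Measure.isProbabilityMeasure_map
        ((AlgState.measurable_assess hb).comp measurable_prodMk_left).aemeasurable

/-- `pick` has finitely many values, so it suffices to treat each fixed pair. -/
theorem measurable_roundLaw (hb : Measurable best) (hp : Measurable pick) :
    Measurable (roundLaw M H q best pick) := by
  have h : Measurable fun y : (Fin H × Fin q.L) × AlgState d H q.L => bodyLaw M H q best y.1 y.2 :=
    measurable_from_prod_countable_right fun p => measurable_bodyLaw H M q hb p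
  have h' : Measurable fun x => bodyLaw M H q best (pick x) x :=
    h.comp (g := fun y : (Fin H × Fin q.L) × AlgState d H q.L => bodyLaw M H q best y.1 y.2)
      (f := fun x => (pick x, x)) (hp.prodMk measurable_id)
  exact Measurable.ite (measurableSet_halted q.ε) Measure.measurable_dirac h'

theorem isProbabilityMeasure_roundLaw (hb : Measurable best) (x : AlgState d H q.L) :
    IsProbabilityMeasure (roundLaw M H q best pick x) := by
  unfold roundLaw
  split_ifs
  · infer_instance
  · exact isProbabilityMeasure_bodyLaw H M q hb _ _

theorem isProbabilityMeasure_runLaw (hb : Measurable best) (hp : Measurable pick) (n : ℕ) :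
    IsProbabilityMeasure (runLaw M H q best pick n) := by
  induction n with
  | zero => rw [runLaw]; infer_instance
  | succ n ih =>
    rw [runLaw]
    exact isProbabilityMeasure_bind' (measurable_roundLaw H M q hb hp)
      fun x => isProbabilityMeasure_roundLaw H M q hb x

end MeasurableRound

end BallRL

end

noncomputable section

namespace BallRL

universe u
variable {d : ℕ} {S : ℕ → Type u} [∀ h, MeasurableSpace (S h)]
variable {M : MDP d S} {H : ℕ} {θ : ℕ → Vec d} {Θ : ℝ} {q : Params}
  {best : (Fin q.L → ℝ) → Fin q.L} {pick : AlgState d H q.L → Fin H × Fin q.L}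

/-! ### Termination and number of rounds -/

section Termination

/-- Number of trajectories collected in one round. -/
def roundCost (d : ℕ) (q : Params) : ℕ := (d + 1) * q.M₁ + q.L * q.M₂

theorem AlgState.measurable_assess_right (hb : Measurable best) {m : ℕ} (y : AlgState d H q.L) :
    Measurable fun o : Fin q.L → Fin m → Obs => y.assess best o :=
  (AlgState.measurable_assess hb).comp measurable_prodMk_left

/-- Isolates the facts that termination rests on; the quality of the estimates plays no role in it.
-/
theorem ae_bodyLaw (hA : Assumptions M H θ Θ) (hb : Measurable best) (p : Fin H × Fin q.L)
    (x : AlgState d H q.L) {Q : AlgState d H q.L → Prop} (hQ : MeasurableSet {y | Q y})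
    (h : ∀ y : AlgState d H q.L, y.rad = Function.update x.rad p.1 (x.radEst p.1 p.2) →
      (∀ h l, y.radEst h l ≤ 1) → y.used = x.used + roundCost d q → Q y) :
    ∀ᵐ y ∂(bodyLaw M H q best p x), Q y := by
  rw [bodyLaw_eq]
  refine ae_bind_of_forall (P := fun _ => True) hQ (by simp) fun o _ => ?_
  rw [ae_map_iff (AlgState.measurable_assess_right hb _).aemeasurable hQ]
  have h1 := ae_pi_eval (fun l : Fin q.L => Measure.pi fun _ : Fin q.M₂ =>
    M.obsLaw H (greedy M ((x.learn q.η p o).dir l))) fun l => ae_pi_eval _ fun j =>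
      ae_obsLaw_radius_le hA (greedy M ((x.learn q.η p o).dir l))
  rw [assessLaw]
  filter_upwards [h1] with o' ho'
  refine h _ rfl (fun k l => (avg_mem_Icc (f := fun ω : Obs => ω.1 k) fun j => ho' l j k k.2).2) ?_
  simp only [AlgState.assess, AlgState.learn, roundCost]
  ring

/-- After `n` rounds, either the loop has ended, or the rounds are distributed over the steps in
such a way that each of them doubled the radius of its step. -/
def Progress (ε : ℝ) (U n : ℕ) {L : ℕ} (x : AlgState d H L) : Prop :=
  x.used ≤ n * U ∧ (∀ h, x.rad h ≤ 1) ∧ (∀ h l, x.radEst h l ≤ 1) ∧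
    (Halted ε x ∨ ∃ k : Fin H → ℕ, ∑ h, k h = n ∧ ∀ h, k h = 0 ∨ 2 ^ k h * ε ≤ 2 * x.rad h)

theorem measurableSet_progress (ε : ℝ) (U n : ℕ) {L : ℕ} :
    MeasurableSet {x : AlgState d H L | Progress ε U n x} := by
  have h1 := AlgState.measurable_rad (d := d) (H := H) (L := L)
  have h2 := AlgState.measurable_radEst (d := d) (H := H) (L := L)
  have h3 := AlgState.measurable_used (d := d) (H := H) (L := L)
  unfold Progress
  refine measurableSet_setOfPred.2 (Measurable.and ?_ (Measurable.and ?_ (Measurable.and ?_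
    (Measurable.or ?_ ?_))))
  · exact measurableSet_setOfPred.1 (measurableSet_le h3 measurable_const)
  · exact Measurable.forall fun h => measurableSet_setOfPred.1 (measurableSet_le (h1 h) measurable_const)
  · exact Measurable.forall fun h => Measurable.forall fun l =>
      measurableSet_setOfPred.1 (measurableSet_le (h2 h l) measurable_const)
  · exact measurableSet_setOfPred.1 (measurableSet_halted ε)
  · exact Measurable.exists fun k => measurable_const.and (Measurable.forall fun h =>
      measurable_const.or (measurableSet_setOfPred.1
        (measurableSet_le measurable_const ((h1 h).const_mul _))))

theorem ae_roundLaw_progress (hA : Assumptions M H θ Θ) (hb : Measurable best)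
    (hp : IsPick q.ε pick) {n : ℕ} {x : AlgState d H q.L}
    (hx : Progress q.ε (roundCost d q) n x) :
    ∀ᵐ y ∂(roundLaw M H q best pick x), Progress q.ε (roundCost d q) (n + 1) y := by
  have hQ := measurableSet_progress (d := d) (H := H) (L := q.L) q.ε (roundCost d q) (n + 1)
  obtain ⟨h1, h2, h3, h4⟩ := hx
  unfold roundLaw
  split_ifs with hh
  · rw [ae_dirac_iff hQ]
    exact ⟨h1.trans (Nat.mul_le_mul_right _ (Nat.le_succ n)), h2, h3, Or.inl hh⟩
  · refine ae_bodyLaw hA hb _ x hQ fun y hr he hu => ⟨?_, fun h => ?_, he, Or.inr ?_⟩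
    · rw [hu, add_mul, one_mul]
      exact Nat.add_le_add_right h1 _
    · rw [hr, Function.update_apply]
      split_ifs
      exacts [h3 _ _, h2 _]
    · obtain ⟨ha1, ha2⟩ := hp.admissible x hh
      obtain ⟨k, hk, hk'⟩ := h4.resolve_left hh
      refine ⟨Function.update k (pick x).1 (k (pick x).1 + 1), ?_, fun h => ?_⟩
      · rw [Finset.sum_update_of_mem (Finset.mem_univ _), ← hk,
          ← Finset.add_sum_erase _ _ (Finset.mem_univ (pick x).1), Finset.sdiff_singleton_eq_erase]
        ring
      · rw [hr]
        rcases eq_or_ne h (pick x).1 with rfl | hne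
        · simp only [Function.update_self]
          refine Or.inr ?_
          -- At the first exploration of a step the condition `ε ≤ radEst` starts the count; at
          -- later ones `2 * rad ≤ radEst` contributes a factor `2`.
          rcases hk' (pick x).1 with h0 | h0
          · rw [h0, zero_add, pow_one]
            linarith
          · rw [pow_succ]
            linarith
        · simpa only [Function.update_of_ne hne] using hk' h

theorem ae_runLaw_progress (hA : Assumptions M H θ Θ) (hb : Measurable best)
    (hp : IsPick q.ε pick) (n : ℕ) :
    ∀ᵐ x ∂(runLaw M H q best pick n), Progress q.ε (roundCost d q) n x := by
  induction n with
  | zero =>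
    rw [runLaw, ae_dirac_iff (measurableSet_progress _ _ _)]
    exact ⟨by simp [AlgState.start], by simp [AlgState.start], by simp [AlgState.start],
      Or.inr ⟨0, by simp, by simp⟩⟩
  | succ n ih =>
    rw [runLaw]
    exact ae_bind_of_forall (measurableSet_progress _ _ _) ih
      fun x hx => ae_roundLaw_progress hA hb hp hx

/-- Pigeonhole: among more than `H * K` executed rounds some step would be explored at least `K + 1`
times, which forces its radius above `1`. -/
theorem ae_runLaw_halted (hA : Assumptions M H θ Θ) (hb : Measurable best)
    (hp : IsPick q.ε pick) (hε : 0 < q.ε) {K N : ℕ} (hK : 1 < 2 ^ K * q.ε) (hN : H * K < N) :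
    ∀ᵐ x ∂(runLaw M H q best pick N), Halted q.ε x ∧ x.used ≤ N * roundCost d q := by
  filter_upwards [ae_runLaw_progress hA hb hp N] with x hx
  obtain ⟨h1, h2, h3, h4⟩ := hx
  refine ⟨h4.resolve_right ?_, h1⟩
  rintro ⟨k, hk, hk'⟩
  have hle : ∀ h, k h ≤ K := fun h => by
    by_contra hlt
    rcases hk' h with h0 | h0
    · omega
    · have h5 : (2 : ℝ) ^ (K + 1) ≤ 2 ^ k h := pow_le_pow_right₀ (by norm_num) (by omega)
      have h6 := mul_le_mul_of_nonneg_right h5 hε.le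
      rw [pow_succ] at h6
      linarith [h2 h]
  have := Finset.sum_le_sum fun h (_ : h ∈ Finset.univ) => hle h
  simp at this
  omega

end Termination

end BallRL

end

noncomputable section

namespace BallRL

universe u
variable {d : ℕ} {S : ℕ → Type u} [∀ h, MeasurableSpace (S h)]
variable {M : MDP d S} {H : ℕ} {θ : ℕ → Vec d} {Θ : ℝ} {q : Params}
  {best : (Fin q.L → ℝ) → Fin q.L} {pick : AlgState d H q.L → Fin H × Fin q.L}

/-! ### Accuracy of the samples of one round -/

section Explore

/-- The `l`-th candidate for the common norm of the parameters. -/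
def Params.grid (q : Params) (l : Fin q.L) : ℝ := ((l : ℕ) + 1 : ℝ) * q.η

/-- The estimates of the parameters, before the division by the radius. -/
def rawEst (H : ℕ) (ξ : ℝ) {m : ℕ} (o : Option (Fin d) → Fin m → Obs) : Vec d :=
  WithLp.toLp 2 fun i : Fin d =>
    (avg (laterRadii H) (o (some i)) - avg (laterRadii H) (o none)) * ξ
      + avg Prod.snd (o (some i)) - avg Prod.snd (o none)

theorem avg_linear {X : Type*} {m : ℕ} (f g : X → ℝ) (c : ℝ) (o : Fin m → X) :
    avg (fun x => f x + c * g x) o = avg f o + c * avg g o := by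
  simp only [avg, Finset.sum_add_distrib, ← Finset.mul_sum]
  ring

/-- The factor `d` in place of `√d` is affordable, as `η` is `ε / d`. -/
theorem norm_le_of_coord {v : Vec d} {b : ℝ} (h : ∀ i, |v i| ≤ b) : ‖v‖ ≤ d * b := by
  rw [EuclideanSpace.norm_eq]
  refine Real.sqrt_le_iff.2 ⟨?_, ?_⟩
  · exact (Finset.sum_nonneg fun i _ => abs_nonneg (v i)).trans
      ((Finset.sum_le_sum (s := Finset.univ) fun i _ => h i).trans (by simp))
  · have h1 : ∑ i, ‖v i‖ ^ 2 ≤ (∑ i, ‖v i‖) ^ 2 :=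
      Finset.sum_sq_le_sq_sum_of_nonneg fun i _ => norm_nonneg _
    refine h1.trans (pow_le_pow_left₀ (Finset.sum_nonneg fun i _ => norm_nonneg _) ?_ 2)
    exact (Finset.sum_le_sum (s := Finset.univ) fun i _ => h i).trans (by simp)

/-- The gap is `Θ` for the direction `0` and `Θ - θ p.1 i` for the basis vector, so their difference
is the coordinate sought. -/
theorem exploreDir_mean (hA : Assumptions M H θ Θ) (hH : 0 < H) (x : AlgState d H q.L)
    (p : Fin H × Fin q.L) (i : Fin d) :
    (meanReward M H (x.exploreDir p.1 p.2 (some i)) - meanReward M H (x.exploreDir p.1 p.2 none)) +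
      Θ * (∑ k ∈ Finset.Ico 1 H, meanRadius M H (x.exploreDir p.1 p.2 (some i)) k -
        ∑ k ∈ Finset.Ico 1 H, meanRadius M H (x.exploreDir p.1 p.2 none) k) =
      meanRadius M H (x.dir p.2) p.1 * θ p.1 i := by
  have hc : meanRadius M H (x.exploreDir p.1 p.2 (some i)) p.1 = meanRadius M H (x.dir p.2) p.1 :=
    meanRadius_congr fun j hj => by simp [AlgState.exploreDir, hj]
  rw [explore_identity hA hH p.1.2 (fun j hj => by simp [AlgState.exploreDir, hj]) fun j hj => by
    have h1 : ¬ j < p.1 := by omega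
    have h2 : ¬ j = p.1 := by omega
    simp [AlgState.exploreDir, h1, h2], hc]
  have h1 : x.exploreDir p.1 p.2 none p.1 = 0 := by simp [AlgState.exploreDir]
  have h2 : x.exploreDir p.1 p.2 (some i) p.1 = EuclideanSpace.single i (1 : ℝ) := by
    simp [AlgState.exploreDir]
  rw [h1, h2, gap_zero, gap]
  simp [EuclideanSpace.inner_single_left]
  ring

theorem integrable_snd_obsLaw (hA : Assumptions M H θ Θ) (π : Policy M) :
    Integrable (fun o : Obs => o.2) (M.obsLaw H π) := (boundedFrom_obsLaw hA π).integrable_snd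

theorem integrable_laterRadii (hA : Assumptions M H θ Θ) (π : Policy M) :
    Integrable (laterRadii H) (M.obsLaw H π) :=
  integrable_finsetSum _ fun _ hk =>
    (boundedFrom_obsLaw hA π).integrable_radius (Nat.zero_le _) (Finset.mem_Ico.1 hk).2

theorem sum_Ico_meanRadius_mem (hA : Assumptions M H θ Θ) (w : ℕ → Vec d) :
    ∑ k ∈ Finset.Ico 1 H, meanRadius M H w k ∈ Set.Icc (0 : ℝ) 1 := by
  refine ⟨Finset.sum_nonneg fun _ _ => meanRadius_nonneg _ _, le_trans ?_ (sum_meanRadius hA w)⟩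
  rw [Finset.range_eq_Ico]
  exact Finset.sum_le_sum_of_subset_of_nonneg (Finset.Ico_subset_Ico (by omega) le_rfl)
    fun _ _ _ => meanRadius_nonneg _ _

/-- Using `ξ` for `Θ` biases a coordinate by `ξ - Θ` times a difference of two numbers in `[0, 1]`.
The sampling error comes from one Hoeffding bound per coordinate, applied to reward plus `ξ` times
later radii, a variable with values in `[0, B]`. -/
theorem exploreLaw_bad_le (hA : Assumptions M H θ Θ) (hH : 0 < H) (x : AlgState d H q.L)
    (p : Fin H × Fin q.L) {ξ B τ p₁ : ℝ} (hξ : 0 ≤ ξ) (hB : 1 + ξ ≤ B) (hτ : 0 ≤ τ)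
    (hM : 0 < q.M₁) (hp : 2 * Real.exp (-(τ ^ 2 * q.M₁ / B ^ 2)) ≤ p₁) :
    exploreLaw H M q p x {o | ¬ ‖rawEst H ξ o - meanRadius M H (x.dir p.2) p.1 • θ p.1‖ ≤
      d * (|ξ - Θ| + τ)} ≤ ENNReal.ofReal (d * p₁) := by
  set c := meanRadius M H (x.dir p.2) p.1
  let f : Obs → ℝ := fun o => o.2 + ξ * laterRadii H o
  let μ : Option (Fin d) → Measure Obs := fun i => M.obsLaw H (greedy M (x.exploreDir p.1 p.2 i))
  have hf : Measurable f := measurable_snd.add ((measurable_laterRadii H).const_mul ξ)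
  have hb : ∀ i, ∀ᵐ o ∂(μ i), f o ∈ Set.Icc 0 B := fun i => by
    filter_upwards [ae_obsLaw_bounds hA _, ae_obsLaw_laterRadii hA _] with o h1 h2
    refine ⟨add_nonneg h1.1.1 (mul_nonneg hξ h2.1), le_trans ?_ hB⟩
    exact add_le_add h1.1.2 (mul_le_of_le_one_right hξ h2.2)
  have hint : ∀ i, ∫ o, f o ∂(μ i) = meanReward M H (x.exploreDir p.1 p.2 i) +
      ξ * ∑ k ∈ Finset.Ico 1 H, meanRadius M H (x.exploreDir p.1 p.2 i) k := fun i => by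
    rw [integral_add (integrable_snd_obsLaw hA _) ((integrable_laterRadii hA _).const_mul _),
      integral_const_mul, integral_laterRadii hA]
    rfl
  have hset : {o : Option (Fin d) → Fin q.M₁ → Obs | ¬ ‖rawEst H ξ o - c • θ p.1‖ ≤
      d * (|ξ - Θ| + τ)} ⊆ ⋃ i : Fin d, {o | τ ≤ |avg f (o (some i)) - avg f (o none) -
        (∫ y, f y ∂(μ (some i)) - ∫ y, f y ∂(μ none))|} := by
    intro o ho
    by_contra hno
    refine ho (norm_le_of_coord fun i => ?_)
    simp only [Set.mem_iUnion, Set.mem_ofPred_eq, not_exists, not_le] at hno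
    have h1 := (hno i).le
    have h2 := exploreDir_mean hA hH x p i
    have h3 := sum_Ico_meanRadius_mem hA (x.exploreDir p.1 p.2 (some i))
    have h4 := sum_Ico_meanRadius_mem hA (x.exploreDir p.1 p.2 none)
    rw [hint, hint, avg_linear, avg_linear] at h1
    set s₁ := ∑ k ∈ Finset.Ico 1 H, meanRadius M H (x.exploreDir p.1 p.2 (some i)) k
    set s₀ := ∑ k ∈ Finset.Ico 1 H, meanRadius M H (x.exploreDir p.1 p.2 none) k
    have h5 : |(ξ - Θ) * (s₁ - s₀)| ≤ |ξ - Θ| := by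
      rw [abs_mul]
      refine mul_le_of_le_one_right (abs_nonneg _) (abs_le.2 ⟨?_, ?_⟩) <;>
        linarith [h3.1, h3.2, h4.1, h4.2]
    have h6 : (rawEst H ξ o - c • θ p.1) i = (ξ - Θ) * (s₁ - s₀) +
        (avg (fun o : Obs => o.2) (o (some i)) + ξ * avg (laterRadii H) (o (some i)) -
          (avg (fun o : Obs => o.2) (o none) + ξ * avg (laterRadii H) (o none)) -
          (meanReward M H (x.exploreDir p.1 p.2 (some i)) + ξ * s₁ -
            (meanReward M H (x.exploreDir p.1 p.2 none) + ξ * s₀))) := by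
      have h7 : (rawEst H ξ o - c • θ p.1) i =
          (avg (laterRadii H) (o (some i)) - avg (laterRadii H) (o none)) * ξ
            + avg (fun o : Obs => o.2) (o (some i)) - avg (fun o : Obs => o.2) (o none)
            - c * θ p.1 i := rfl
      rw [h7, ← h2]
      ring
    rw [h6]
    exact (abs_add_le _ _).trans (add_le_add h5 h1)
  refine (measure_mono hset).trans ((measure_iUnion_fintype_le _ _).trans ?_)
  have hi : ∀ i : Fin d, exploreLaw H M q p x {o | τ ≤ |avg f (o (some i)) - avg f (o none) -
        (∫ y, f y ∂(μ (some i)) - ∫ y, f y ∂(μ none))|} ≤ ENNReal.ofReal p₁ := fun i => by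
    have h1 := hasSubgaussianMGF_avg_sub μ hf hb hM (Option.some_ne_none i)
    refine (measure_abs_ge_le_of_subgaussian h1 hτ).trans (ENNReal.ofReal_le_ofReal ?_)
    refine le_trans (le_of_eq ?_) hp
    rw [Real.coe_toNNReal _ (by positivity)]
    congr 2
    have hm : (q.M₁ : ℝ) ≠ 0 := by positivity
    have hB0 : B ≠ 0 := by linarith
    field_simp
  refine (Finset.sum_le_sum fun i _ => hi i).trans (le_of_eq ?_)
  rw [Finset.sum_const, Finset.card_univ, Fintype.card_fin, nsmul_eq_mul,
    ENNReal.ofReal_mul (Nat.cast_nonneg _), ENNReal.ofReal_natCast]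

theorem assessLaw_avg_bad_le (y : AlgState d H q.L) {t p₂ : ℝ} (ht : 0 ≤ t) (hM : 0 < q.M₂)
    (hp : 2 * Real.exp (-(2 * t ^ 2 * q.M₂)) ≤ p₂) (l : Fin q.L) {f : Obs → ℝ} (hf : Measurable f)
    (hb : ∀ᵐ o ∂(M.obsLaw H (greedy M (y.dir l))), f o ∈ Set.Icc (0 : ℝ) 1) {e : ℝ}
    (he : ∫ ω, f ω ∂(M.obsLaw H (greedy M (y.dir l))) = e) :
    assessLaw H M q y {o | t ≤ |avg f (o l) - e|} ≤ ENNReal.ofReal p₂ := by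
  have h1 := hasSubgaussianMGF_avg _ hf hb hM
  rw [he] at h1
  have h2 := measure_abs_ge_le_of_subgaussian h1 ht
  have h3 := (measurePreserving_eval (fun l => Measure.pi fun _ : Fin q.M₂ =>
    M.obsLaw H (greedy M (y.dir l))) l).measure_preimage (s := {o | t ≤ |avg f o - e|})
      (measurableSet_le measurable_const
        (measurable_norm.comp ((measurable_avg hf).sub_const _))).nullMeasurableSet
  refine (le_of_eq h3).trans (h2.trans (ENNReal.ofReal_le_ofReal (le_trans (le_of_eq ?_) hp)))
  rw [Real.coe_toNNReal _ (by positivity)]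
  congr 2
  have hm : (q.M₂ : ℝ) ≠ 0 := by positivity
  field_simp
  norm_num

/-- The factor `(H + 1) * q.L` counts `H` radii and one reward for each of the `L` policies. -/
theorem assessLaw_bad_le (hA : Assumptions M H θ Θ) (y : AlgState d H q.L) {t p₂ : ℝ} (ht : 0 ≤ t)
    (hM : 0 < q.M₂) (hp : 2 * Real.exp (-(2 * t ^ 2 * q.M₂)) ≤ p₂) :
    assessLaw H M q y {o | ¬ ((∀ (h : Fin H) l,
        |avg (fun ω : Obs => ω.1 h) (o l) - meanRadius M H (y.dir l) h| ≤ t) ∧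
      ∀ l, |avg Prod.snd (o l) - meanReward M H (y.dir l)| ≤ t)} ≤
      ENNReal.ofReal ((H + 1) * q.L * p₂) := by
  have hp0 : 0 ≤ p₂ := le_trans (by positivity) hp
  have hset : {o : Fin q.L → Fin q.M₂ → Obs | ¬ ((∀ (h : Fin H) l,
        |avg (fun ω : Obs => ω.1 h) (o l) - meanRadius M H (y.dir l) h| ≤ t) ∧
      ∀ l, |avg Prod.snd (o l) - meanReward M H (y.dir l)| ≤ t)} ⊆
      (⋃ z : Fin H × Fin q.L, {o | t ≤ |avg (fun ω : Obs => ω.1 z.1) (o z.2) -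
        meanRadius M H (y.dir z.2) z.1|}) ∪
      ⋃ l : Fin q.L, {o | t ≤ |avg Prod.snd (o l) - meanReward M H (y.dir l)|} := by
    intro o ho
    by_contra hno
    simp only [Set.mem_union, Set.mem_iUnion, Set.mem_ofPred_eq, not_or, not_exists, not_le] at hno
    exact ho ⟨fun h l => (hno.1 (h, l)).le, fun l => (hno.2 l).le⟩
  have hi : ∀ z : Fin H × Fin q.L, assessLaw H M q y {o | t ≤ |avg (fun ω : Obs => ω.1 z.1) (o z.2) -
      meanRadius M H (y.dir z.2) z.1|} ≤ ENNReal.ofReal p₂ := fun z =>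
    assessLaw_avg_bad_le y ht hM hp z.2 (f := fun ω : Obs => ω.1 z.1) (by fun_prop)
      ((ae_obsLaw_radius_le hA _).mono fun o ho => ho _ z.1.2) rfl
  have hi' : ∀ l : Fin q.L, assessLaw H M q y {o | t ≤ |avg Prod.snd (o l) -
      meanReward M H (y.dir l)|} ≤ ENNReal.ofReal p₂ := fun l =>
    assessLaw_avg_bad_le y ht hM hp l measurable_snd
      ((ae_obsLaw_bounds hA _).mono fun o ho => ho.1) rfl
  calc
    _ ≤ _ := measure_mono hset
    _ ≤ _ := measure_union_le _ _
    _ ≤ _ := add_le_add (measure_iUnion_fintype_le _ _) (measure_iUnion_fintype_le _ _)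
    _ ≤ _ := add_le_add (Finset.sum_le_sum fun z _ => hi z) (Finset.sum_le_sum fun l _ => hi' l)
    _ = ENNReal.ofReal ((H * q.L : ℕ) * p₂ + q.L * p₂) := by
      rw [ENNReal.ofReal_add (by positivity) (by positivity), ENNReal.ofReal_mul (by positivity),
        ENNReal.ofReal_mul (by positivity), ENNReal.ofReal_natCast, ENNReal.ofReal_natCast]
      simp
    _ = _ := by
      congr 1
      push_cast
      ring

end Explore

end BallRL

end

noncomputable section

namespace BallRL

universe u
variable {d : ℕ} {S : ℕ → Type u} [∀ h, MeasurableSpace (S h)]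
variable {M : MDP d S} {H : ℕ} {θ : ℕ → Vec d} {Θ : ℝ} {q : Params}
  {best : (Fin q.L → ℝ) → Fin q.L} {pick : AlgState d H q.L → Fin H × Fin q.L}

/-! ### The invariant of the loop and its consequences -/

section Good

variable (M θ Θ q) in
/-- The direction that the `l`-th policy plays at step `h` is accurate, if step `h` has been
explored (or the norm `Θ` is so small that directions do not matter, as expressed by `small`). -/
def Learned (small : Prop) (l : Fin q.L) (x : AlgState d H q.L) (h : Fin H) : Prop :=
  small ∨ ((h : ℕ) = 0 ∧ meanRadius M H 0 0 * gap Θ (x.est h l) (θ h) ≤ 5 / 2 * q.ε) ∨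
    ((h : ℕ) ≠ 0 ∧ (x.rad h = 0 ∨
      q.ε ≤ x.rad h ∧ 3 / 4 * x.rad h * gap Θ (x.est h l) (θ h) ≤ 5 / 2 * q.ε))

variable (M q) in
/-- The radii and rewards of the policies are known up to `ε / 4`. -/
def Accurate (x : AlgState d H q.L) : Prop :=
  (∀ h l, |x.radEst h l - meanRadius M H (x.dir l) h| ≤ q.ε / 4) ∧
    ∀ b, x.best = b → ∀ l, meanReward M H (x.dir l) ≤ meanReward M H (x.dir b) + q.ε / 2

variable (M θ Θ q) in
/-- The memory is as it should be after a round. -/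
def Good (small : Prop) (l : Fin q.L) (x : AlgState d H q.L) : Prop :=
  Accurate M q x ∧ ∀ h, Learned M θ Θ q small l x h

/-- The quantifier over the value `b` of `best` in `Accurate` makes this a finite combination of
measurable conditions. -/
theorem measurableSet_good (small : Prop) (l : Fin q.L) :
    MeasurableSet {x : AlgState d H q.L | Good M θ Θ q small l x} := by
  have h1 := AlgState.measurable_rad (d := d) (H := H) (L := q.L)
  have h2 := AlgState.measurable_radEst (d := d) (H := H) (L := q.L)
  have h3 := AlgState.measurable_est (d := d) (H := H) (L := q.L)
  have h4 := AlgState.measurable_dir (d := d) (H := H) (L := q.L)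
  have h5 : ∀ h, Measurable fun x : AlgState d H q.L => gap Θ (x.est h l) (θ h) := fun h =>
    (measurable_gap Θ (θ h)).comp (h3 h l)
  unfold Good Accurate Learned
  refine measurableSet_setOfPred.2 (((Measurable.forall fun h => Measurable.forall fun k => ?_).and
    (Measurable.forall fun b => Measurable.imp ?_ (Measurable.forall fun k => ?_))).and (Measurable.forall fun h => measurable_const.or
      ((measurable_const.and ?_).or (measurable_const.and (Measurable.or ?_ (Measurable.and ?_ ?_))))))
  · exact measurableSet_setOfPred.1 (measurableSet_le (measurable_norm.comp
      ((h2 h k).sub ((measurable_meanRadius M H h).comp (h4 k)))) measurable_const)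
  · exact AlgState.measurable_best.eq_const b
  · exact measurableSet_setOfPred.1 (measurableSet_le ((measurable_meanReward M H).comp (h4 k))
      (((measurable_meanReward M H).comp (h4 b)).add_const _))
  · exact measurableSet_setOfPred.1 (measurableSet_le ((h5 h).const_mul _) measurable_const)
  · exact (h1 h).eq_const 0
  · exact measurableSet_setOfPred.1 (measurableSet_le measurable_const (h1 h))
  · exact measurableSet_setOfPred.1 (measurableSet_le (((h1 h).const_mul _).mul (h5 h))
      measurable_const)

theorem learn_est_self (x : AlgState d H q.L) (p : Fin H × Fin q.L) {m : ℕ}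
    (o : Option (Fin d) → Fin m → Obs) (l : Fin q.L) :
    (x.learn q.η p o).est p.1 l = (x.radEst p.1 p.2)⁻¹ • rawEst H (q.grid l) o := by
  ext i
  simp only [AlgState.learn, Function.update_self, rawEst, Params.grid, PiLp.smul_apply, smul_eq_mul]
  rw [div_eq_inv_mul]

/-- One exploration along policy `p.2` serves every candidate `l`, since the vector being estimated
is a multiple of `θ p.1` in any case; dividing by `radEst` does not affect directions. The bound `5
/ 2 * ε` is twice the estimation error, by `mul_gap_le`. -/
theorem learned_learn (hA : Assumptions M H θ Θ) (hε : 0 < q.ε) {small : Prop}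
    {l : Fin q.L} {x : AlgState d H q.L} {p : Fin H × Fin q.L}
    (hp : q.ε ≤ x.radEst p.1 p.2)
    (hr : (p.1 : ℕ) = 0 ∨ |x.radEst p.1 p.2 - meanRadius M H (x.dir p.2) p.1| ≤ q.ε / 4)
    (hx : ∀ h, h ≠ p.1 → Learned M θ Θ q small l x h) {m : ℕ} {o : Option (Fin d) → Fin m → Obs}
    (ho : small ∨ ‖rawEst H (q.grid l) o - meanRadius M H (x.dir p.2) p.1 • θ p.1‖ ≤ 5 / 4 * q.ε)
    (h : Fin H) : Learned M θ Θ q small l (x.learn q.η p o) h := by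
  rcases eq_or_ne h p.1 with rfl | hne
  · refine ho.imp id fun ho => ?_
    have hpos : 0 < x.radEst p.1 p.2 := hε.trans_le hp
    have hg : gap Θ ((x.learn q.η p o).est p.1 l) (θ p.1) = gap Θ (rawEst H (q.grid l) o) (θ p.1) := by
      rw [learn_est_self, gap_smul (inv_pos.2 hpos)]
    have hn := hA.norm_eq p.1 p.1.2
    have h1 := mul_gap_le (meanRadius_nonneg (M := M) (H := H) (x.dir p.2) p.1) hn
      (rawEst H (q.grid l) o)
    have h2 : meanRadius M H (x.dir p.2) p.1 * gap Θ (rawEst H (q.grid l) o) (θ p.1) ≤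
        5 / 2 * q.ε := by linarith
    rw [hg]
    by_cases h0 : (p.1 : ℕ) = 0
    · refine Or.inl ⟨h0, ?_⟩
      -- No action precedes the first step, so its mean radius is that of any policy and needs no
      -- estimate.
      rw [meanRadius_congr (w' := 0) fun j hj => by omega] at h2
      rwa [h0] at h2 ⊢
    · refine Or.inr ⟨h0, Or.inr ?_⟩
      simp only [AlgState.learn, Function.update_self]
      refine ⟨hp, le_trans ?_ h2⟩
      have h3 := (abs_le.1 (hr.resolve_left h0)).2
      -- The error `ε / 4` is at most a quarter of the recorded radius, hence the factor `3 / 4`.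
      refine mul_le_mul_of_nonneg_right ?_ (gap_nonneg hn _)
      linarith
  · have := hx h hne
    unfold Learned at this ⊢
    simpa only [AlgState.learn, Function.update_of_ne hne] using this

theorem good_assess (hb : IsArgmax best) {small : Prop} {l : Fin q.L} {y : AlgState d H q.L}
    (hy : ∀ h, Learned M θ Θ q small l y h) {m : ℕ} {o : Fin q.L → Fin m → Obs}
    (ho : (∀ (h : Fin H) l,
        |avg (fun ω : Obs => ω.1 h) (o l) - meanRadius M H (y.dir l) h| ≤ q.ε / 4) ∧
      ∀ l, |avg Prod.snd (o l) - meanReward M H (y.dir l)| ≤ q.ε / 4) :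
    Good M θ Θ q small l (y.assess best o) := by
  refine ⟨⟨ho.1, ?_⟩, hy⟩
  rintro _ rfl k
  change meanReward M H (y.dir k) ≤ meanReward M H (y.dir (best fun l => avg Prod.snd (o l))) + _
  have h1 := (abs_le.1 (ho.2 k)).1
  have h2 := (abs_le.1 (ho.2 (best fun l => avg Prod.snd (o l)))).2
  have h3 : avg Prod.snd (o k) ≤ avg Prod.snd (o (best fun l => avg Prod.snd (o l))) :=
    hb.max (fun l => avg Prod.snd (o l)) k
  linarith

/-- What the sample sizes have to achieve. -/
structure SampleSize (d : ℕ) (q : Params) (Θ τ B p₁ p₂ : ℝ) (small : Prop) (l : Fin q.L) : Prop where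
  ε_pos : 0 < q.ε
  η_nonneg : 0 ≤ q.η
  M₁_pos : 0 < q.M₁
  M₂_pos : 0 < q.M₂
  τ_nonneg : 0 ≤ τ
  explore : 2 * Real.exp (-(τ ^ 2 * q.M₁ / B ^ 2)) ≤ p₁
  assess : 2 * Real.exp (-(2 * (q.ε / 4) ^ 2 * q.M₂)) ≤ p₂
  grid : small ∨ (d * (|q.grid l - Θ| + τ) ≤ 5 / 4 * q.ε ∧ 1 + q.grid l ≤ B)

variable {τ B p₁ p₂ : ℝ} {small : Prop} {l : Fin q.L}

/-- Exploration fails with probability at most `d * p₁`; after any exploration that succeeds,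
assessment fails with at most `(H + 1) * L * p₂`. The explored step is exempt from `hx` because its
estimates are overwritten, and step `0` from the accuracy in `hr` so that the first round is
covered. -/
theorem bodyLaw_not_good_le (hA : Assumptions M H θ Θ) (hH : 0 < H) (hb : IsArgmax best)
    (hs : SampleSize d q Θ τ B p₁ p₂ small l) {x : AlgState d H q.L} {p : Fin H × Fin q.L}
    (hp : q.ε ≤ x.radEst p.1 p.2)
    (hr : (p.1 : ℕ) = 0 ∨ |x.radEst p.1 p.2 - meanRadius M H (x.dir p.2) p.1| ≤ q.ε / 4)
    (hx : ∀ h, h ≠ p.1 → Learned M θ Θ q small l x h) :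
    bodyLaw M H q best p x {y | ¬ Good M θ Θ q small l y} ≤
      ENNReal.ofReal (d * p₁ + (H + 1) * q.L * p₂) := by
  have hp₁ : 0 ≤ p₁ := le_trans (by positivity) hs.explore
  have hp₂ : 0 ≤ p₂ := le_trans (by positivity) hs.assess
  let E : Set (Option (Fin d) → Fin q.M₁ → Obs) := {o | ¬ (small ∨
    ‖rawEst H (q.grid l) o - meanRadius M H (x.dir p.2) p.1 • θ p.1‖ ≤ 5 / 4 * q.ε)}
  have hE : exploreLaw H M q p x E ≤ ENNReal.ofReal (d * p₁) := by
    rcases hs.grid with h | ⟨h1, h2⟩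
    · have : E = ∅ := by
        ext o
        simp [E, h]
      simp [this]
    · refine le_trans (measure_mono ?_) (exploreLaw_bad_le hA hH x p (ξ := q.grid l)
        (mul_nonneg (by positivity) hs.η_nonneg) h2 hs.τ_nonneg hs.M₁_pos hs.explore)
      exact fun o ho hc => ho (Or.inr (hc.trans h1))
  have hgood : MeasurableSet {y : AlgState d H q.L | ¬ Good M θ Θ q small l y} :=
    (measurableSet_good small l).compl
  have key : ∀ o, (assessLaw H M q (x.learn q.η p o)).map
      (fun o' => (x.learn q.η p o).assess best o') {y | ¬ Good M θ Θ q small l y} ≤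
      E.indicator (fun _ => 1) o + ENNReal.ofReal ((H + 1) * q.L * p₂) := by
    intro o
    have hm := AlgState.measurable_assess_right hb.meas (m := q.M₂) (x.learn q.η p o)
    by_cases ho : o ∈ E
    · have := Measure.isProbabilityMeasure_map hm.aemeasurable
        (μ := assessLaw H M q (x.learn q.η p o))
      rw [Set.indicator_of_mem ho]
      exact prob_le_one.trans le_self_add
    · rw [Set.indicator_of_notMem ho, zero_add, Measure.map_apply hm hgood]
      refine le_trans (measure_mono ?_) (assessLaw_bad_le hA (x.learn q.η p o) (t := q.ε / 4)
        (by linarith [hs.ε_pos]) hs.M₂_pos hs.assess)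
      exact fun o' ho' hc =>
        ho' (good_assess hb (learned_learn hA hs.ε_pos hp hr hx (not_not.1 ho)) hc)
  rw [bodyLaw_eq]
  calc
    _ ≤ _ := Measure.bind_apply_le _ hgood
    _ ≤ ∫⁻ o, (E.indicator (fun _ => 1) o + ENNReal.ofReal ((H + 1) * q.L * p₂))
        ∂(exploreLaw H M q p x) := lintegral_mono key
    _ ≤ 1 * exploreLaw H M q p x E + ENNReal.ofReal ((H + 1) * q.L * p₂) := by
      rw [lintegral_add_right _ measurable_const, lintegral_const, measure_univ, mul_one]
      gcongr
      exact lintegral_indicator_const_le _ _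
    _ ≤ ENNReal.ofReal (d * p₁) + ENNReal.ofReal ((H + 1) * q.L * p₂) := by
      rw [one_mul]
      gcongr
    _ = _ := (ENNReal.ofReal_add (by positivity) (by positivity)).symm

theorem roundLaw_not_good_le (hA : Assumptions M H θ Θ) (hH : 0 < H) (hb : IsArgmax best)
    (hp : IsPick q.ε pick) (hs : SampleSize d q Θ τ B p₁ p₂ small l) {x : AlgState d H q.L}
    (hx : Good M θ Θ q small l x) :
    roundLaw M H q best pick x {y | ¬ Good M θ Θ q small l y} ≤
      ENNReal.ofReal (d * p₁ + (H + 1) * q.L * p₂) := by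
  unfold roundLaw
  split_ifs with hh
  · have hgood : MeasurableSet {y : AlgState d H q.L | ¬ Good M θ Θ q small l y} :=
      (measurableSet_good small l).compl
    rw [Measure.dirac_apply' _ hgood]
    simp [hx]
  · exact bodyLaw_not_good_le hA hH hb hs (hp.admissible x hh).2 (Or.inr (hx.1.1 _ _))
      fun h _ => hx.2 h

/-- A union bound over the rounds. The initial `radEst = 1` is not an average of samples, so the
invariant begins only after the first round; that round explores step `0`, where no accurate radius
is required, and all other steps still have `rad = 0`. -/
theorem runLaw_not_good_le (hA : Assumptions M H θ Θ) (hH : 0 < H) (hb : IsArgmax best)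
    (hp : IsPick q.ε pick) (hs : SampleSize d q Θ τ B p₁ p₂ small l) (hε : q.ε ≤ 1) (n : ℕ) :
    runLaw M H q best pick (n + 1) {y | ¬ Good M θ Θ q small l y} ≤
      (n + 1 : ℕ) * ENNReal.ofReal (d * p₁ + (H + 1) * q.L * p₂) := by
  have hm := measurable_roundLaw H M q hb.meas hp.meas
  have hgood : MeasurableSet {y : AlgState d H q.L | ¬ Good M θ Θ q small l y} :=
    (measurableSet_good small l).compl
  set β := ENNReal.ofReal (d * p₁ + (H + 1) * q.L * p₂)
  induction n with
  | zero =>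
    rw [runLaw, runLaw, Measure.dirac_bind hm]
    set x : AlgState d H q.L := AlgState.start (best 0)
    have hnot : ¬ Halted q.ε x := fun h => h (⟨0, hH⟩, best 0) ⟨by simp [x, AlgState.start], hε⟩
    unfold roundLaw
    rw [if_neg hnot]
    refine (bodyLaw_not_good_le hA hH hb hs (hp.admissible x hnot).2 (Or.inl (hp.first _))
      fun h hne => Or.inr (Or.inr ⟨fun h0 => hne (Fin.ext ?_), Or.inl rfl⟩)).trans (by simp [β])
    rw [h0, hp.first]
  | succ n ih =>
    rw [runLaw]
    calc
      _ ≤ _ := Measure.bind_apply_le _ hgood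
      _ ≤ ∫⁻ x, ({y | ¬ Good M θ Θ q small l y}.indicator (fun _ => 1) x + β)
          ∂(runLaw M H q best pick (n + 1)) := by
        refine lintegral_mono fun x => ?_
        have := isProbabilityMeasure_roundLaw H M q (pick := pick) hb.meas x
        by_cases hx : Good M θ Θ q small l x
        · exact (roundLaw_not_good_le hA hH hb hp hs hx).trans le_add_self
        · rw [Set.indicator_of_mem (show x ∈ {y | ¬ Good M θ Θ q small l y} from hx)]
          exact prob_le_one.trans le_self_add
      _ ≤ 1 * runLaw M H q best pick (n + 1) {y | ¬ Good M θ Θ q small l y} + β := by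
        have := isProbabilityMeasure_runLaw H M q hb.meas hp.meas (n + 1)
        rw [lintegral_add_right _ measurable_const, lintegral_const, measure_univ, mul_one]
        gcongr
        exact lintegral_indicator_const_le _ _
      _ ≤ _ := by
        rw [one_mul, Nat.cast_succ (n + 1), add_mul, one_mul]
        gcongr

theorem epsOptimal_of_loss (hA : Assumptions M H θ Θ) {ϵ : ℝ} {w : ℕ → Vec d}
    (h : (∫ s, M.Vstar H 0 s ∂M.init) - meanReward M H w ≤ ϵ) (hH : 0 < H) :
    M.EpsOptimal H ϵ (greedy M w) := by
  rw [MDP.EpsOptimal, integral_V hA, abs_sub_comm, abs_of_nonneg]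
  · exact h
  · have h1 := meanReward_eq hA hH w
    have h2 : 0 ≤ ∑ k ∈ Finset.range H, gap Θ (w k) (θ k) * meanRadius M H w k :=
      Finset.sum_nonneg fun k hk => mul_nonneg (gap_nonneg (hA.norm_eq k (Finset.mem_range.1 hk)) _)
        (meanRadius_nonneg _ _)
    have h3 : ∫ o, o.2 ∂(M.obsLaw H (greedy M w)) = meanReward M H w := rfl
    rw [h3]
    linarith

theorem integral_Vstar_le_one (hA : Assumptions M H θ Θ) (hH : 0 < H) :
    ∫ s, M.Vstar H 0 s ∂M.init ≤ 1 := by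
  have h1 := meanReward_eq hA hH θ
  rw [Finset.sum_eq_zero fun k hk => by
    rw [gap_self (hA.norm_eq k (Finset.mem_range.1 hk)), zero_mul], sub_zero] at h1
  rw [← h1]
  exact (meanReward_mem hA θ).2

theorem epsOptimal_of_one_le (hA : Assumptions M H θ Θ) (hH : 0 < H) {ϵ : ℝ} (hϵ : 1 ≤ ϵ)
    (w : ℕ → Vec d) : M.EpsOptimal H ϵ (greedy M w) := by
  refine epsOptimal_of_loss hA ?_ hH
  linarith [integral_Vstar_le_one hA hH, (meanReward_mem hA w).1]

/-- Halting means that the pair `(h, l)` violates the loop condition: the estimated radius is below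
`ε`, where any direction will do, or below twice the recorded radius, where the old estimate is
still adequate. An unexplored step falls under the former case. -/
theorem loss_le_of_learned (hA : Assumptions M H θ Θ) (hε : 0 < q.ε) {x : AlgState d H q.L}
    (hsmall : small → 2 * Θ ≤ q.ε)
    (hacc : Accurate M q x) (hh : Halted q.ε x) (h : Fin H) (hx : Learned M θ Θ q small l x h) :
    gap Θ (x.dir l h) (θ h) * meanRadius M H (x.dir l) h ≤ 15 / 2 * q.ε := by
  have hdir : x.dir l h = x.est h l := by simp [AlgState.dir]
  have hn := hA.norm_eq h h.2
  have hg0 := gap_nonneg hn (x.est h l)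
  have hg2 := gap_le hn (x.est h l)
  have hc0 := meanRadius_nonneg (M := M) (H := H) (x.dir l) h
  have hc1 : meanRadius M H (x.dir l) h ≤ 1 :=
    (Finset.single_le_sum (f := fun k => meanRadius M H (x.dir l) k)
      (fun k _ => meanRadius_nonneg _ k) (Finset.mem_range.2 h.2)).trans (sum_meanRadius hA _)
  rw [hdir]
  set g := gap Θ (x.est h l) (θ h)
  set c := meanRadius M H (x.dir l) h with hc
  rcases hx with hx | ⟨h0, hx⟩ | ⟨h0, hx⟩
  · have := hsmall hx
    nlinarith
  · rw [hc, meanRadius_congr (w' := 0) fun j hj => by omega, h0]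
    linarith
  · have h1 := (abs_le.1 (hacc.1 h l)).1
    rw [← hc] at h1
    have hlt : x.radEst h l < q.ε ∨
        (q.ε ≤ x.rad h ∧ 3 / 4 * x.rad h * g ≤ 5 / 2 * q.ε) ∧ x.radEst h l < 2 * x.rad h := by
      by_contra hcon
      rw [not_or, not_lt] at hcon
      obtain ⟨ha, hb⟩ := hcon
      refine hh (h, l) ⟨?_, ha⟩
      rcases hx with hx | hx
      · rw [hx]
        linarith
      · by_contra hc'
        exact hb ⟨hx, not_le.1 hc'⟩
    rcases hlt with hlt | ⟨⟨h2, h3⟩, h4⟩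
    · have h5 : c ≤ 5 / 4 * q.ε := by linarith
      have h6 : g ≤ 2 := by linarith [hA.norm_le]
      nlinarith
    -- Twice the recorded radius plus the error `ε / 4`, which is at most a quarter of it. As `9 /
    -- 4` is three times `3 / 4`, the bound `5 / 2 * ε` triples.
    · have h5 : c ≤ 9 / 4 * x.rad h := by linarith
      calc g * c ≤ g * (9 / 4 * x.rad h) := mul_le_mul_of_nonneg_left h5 hg0
        _ = 3 * (3 / 4 * x.rad h * g) := by ring
        _ ≤ _ := by linarith

/-- Only policy `l` is known to be nearly optimal, but the output earns at most `ε / 2` less, and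
$\tfrac{15}{2}H\varepsilon+\tfrac12\varepsilon\le 8H\varepsilon$. -/
theorem epsOptimal_of_good (hA : Assumptions M H θ Θ) (hH : 0 < H) (hε : 0 < q.ε) {ϵ : ℝ}
    (hϵ : 8 * H * q.ε ≤ ϵ) (hsmall : small → 2 * Θ ≤ q.ε) {x : AlgState d H q.L}
    (hx : Good M θ Θ q small l x) (hh : Halted q.ε x) : M.EpsOptimal H ϵ (x.output M) := by
  refine epsOptimal_of_loss hA ?_ hH
  have h1 : meanReward M H (x.dir l) ≤ meanReward M H (x.dir x.best) + q.ε / 2 := hx.1.2 _ rfl l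
  have h2 := meanReward_eq hA hH (x.dir l)
  have h3 : ∑ k ∈ Finset.range H, gap Θ (x.dir l k) (θ k) * meanRadius M H (x.dir l) k ≤
      ∑ _k ∈ Finset.range H, 15 / 2 * q.ε := Finset.sum_le_sum fun k hk =>
    loss_le_of_learned hA hε hsmall hx.1 hh ⟨k, Finset.mem_range.1 hk⟩ (hx.2 _)
  rw [Finset.sum_const, Finset.card_range, nsmul_eq_mul] at h3
  have h4 : (1 : ℝ) * q.ε ≤ H * q.ε := mul_le_mul_of_nonneg_right (by exact_mod_cast hH) hε.le
  linarith

end Good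

end BallRL

end

noncomputable section

namespace BallRL

/-! ### Numerical estimates for the chosen parameters -/

section Numbers

/-- The confidence level of a single estimate. -/
def failProb (d H L : ℕ) (ε δ : ℝ) : ℝ := δ / ((d + 3 * H * L) * (1 + H * Real.logb 2 (1 / ε)))

/-- Number of rounds after which the algorithm has stopped. -/
def roundBound (H : ℕ) (ε : ℝ) : ℕ := H * (⌊Real.logb 2 (1 / ε)⌋₊ + 1) + 1

/-- Rounding `Θ / η - 1 / 2` up gives a nearest multiple of `η`. It is a positive multiple because
`η / 2 < Θ`, so the index, which counts from `0`, can be one less. -/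
theorem exists_grid_point {η Θ : ℝ} (hη : 0 < η) (hΘ : η / 2 < Θ) (hΘ1 : Θ ≤ 1) :
    ∃ l : Fin ⌈1 / η⌉₊, |((l : ℕ) + 1 : ℝ) * η - Θ| ≤ η / 2 := by
  have h0 : 0 < Θ / η - 1 / 2 := by
    rw [sub_pos, div_lt_div_iff₀ (by norm_num) hη]
    linarith
  have h1 : 0 < ⌈Θ / η - 1 / 2⌉₊ := Nat.ceil_pos.2 h0
  have h2 : ⌈Θ / η - 1 / 2⌉₊ ≤ ⌈1 / η⌉₊ := by
    refine Nat.ceil_le_ceil ?_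
    have : Θ / η ≤ 1 / η := div_le_div_of_nonneg_right hΘ1 hη.le
    linarith
  have h3 := Nat.le_ceil (Θ / η - 1 / 2)
  have h4 := Nat.ceil_lt_add_one h0.le
  refine ⟨⟨⌈Θ / η - 1 / 2⌉₊ - 1, by omega⟩, ?_⟩
  have h5 : ((⌈Θ / η - 1 / 2⌉₊ - 1 : ℕ) : ℝ) + 1 = (⌈Θ / η - 1 / 2⌉₊ : ℝ) := by
    rw [Nat.cast_sub h1]
    simp
  simp only [h5]
  have h6 : Θ / η * η = Θ := div_mul_cancel₀ _ hη.ne'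
  rw [abs_le]
  constructor <;> nlinarith

variable {d H : ℕ} {ϵ δ : ℝ}

theorem logb_inv_nonneg {ε : ℝ} (hε : 0 < ε) (hε1 : ε ≤ 1) : 0 ≤ Real.logb 2 (1 / ε) :=
  Real.logb_nonneg (by norm_num) (by rw [le_div_iff₀ hε]; linarith)

theorem one_lt_two_pow_mul {ε : ℝ} (hε : 0 < ε) :
    1 < 2 ^ (⌊Real.logb 2 (1 / ε)⌋₊ + 1) * ε := by
  have h1 := Nat.lt_floor_add_one (Real.logb 2 (1 / ε))
  have h2 := (Real.logb_lt_iff_lt_rpow (by norm_num) (by positivity)).1 h1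
  rw [← Nat.cast_add_one, Real.rpow_natCast, div_lt_iff₀ hε] at h2
  exact h2

theorem roundBound_le {ε : ℝ} (hε : 0 < ε) (hε1 : ε ≤ 1) :
    (roundBound H ε : ℝ) ≤ H * (Real.logb 2 (1 / ε) + 1) + 1 := by
  have h1 := Nat.floor_le (logb_inv_nonneg hε hε1)
  rw [roundBound]
  push_cast
  gcongr

/-- The union bound over all rounds. -/
theorem total_failure_le {L : ℕ} {ε : ℝ} (hd : 0 < d) (hH : 0 < H) (hε : 0 < ε) (hε1 : ε ≤ 1)
    (hδ : 0 < δ) (hδ1 : δ < 1) (hL : 8 * H * d ≤ L) :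
    (roundBound H ε : ℝ) * (d * (2 * failProb d H L ε δ) +
      (H + 1) * L * (2 * failProb d H L ε δ ^ 2)) ≤ δ := by
  have hd' : (1 : ℝ) ≤ d := by exact_mod_cast hd
  have hH' : (1 : ℝ) ≤ H := by exact_mod_cast hH
  have hL' : (8 : ℝ) * H * d ≤ L := by exact_mod_cast hL
  have hlog := logb_inv_nonneg hε hε1
  have hN := roundBound_le (H := H) hε hε1
  set lam := Real.logb 2 (1 / ε)
  set D₁ : ℝ := d + 3 * H * L with hD₁
  set D₂ : ℝ := 1 + H * lam with hD₂
  have hHd : (1 : ℝ) ≤ H * d := by nlinarith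
  have hL1 : (8 : ℝ) ≤ L := by nlinarith
  have hD₁L : 3 * H * L ≤ D₁ := by linarith
  have hHL : (8 : ℝ) ≤ H * L := by nlinarith
  have hD₁0 : 0 < D₁ := by nlinarith
  have hD₂0 : 1 ≤ D₂ := by nlinarith
  have hf : failProb d H L ε δ = δ / (D₁ * D₂) := rfl
  set f := failProb d H L ε δ
  have hf0 : 0 < f := by rw [hf]; positivity
  -- The number of rounds may exceed the factor `D₂` of the confidence level by as much as `2 * H`.
  -- This is absorbed because `8 * H * d ≤ L` makes `D₁` at least `24 * H * d` and because
  -- assessment failures enter squared.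
  have hND : (roundBound H ε : ℝ) ≤ 2 * H * D₂ := by
    have : H * lam ≤ H * (H * lam) := by nlinarith [mul_nonneg (by linarith : (0:ℝ) ≤ H) hlog]
    nlinarith
  have hDf : D₂ * f * D₁ = δ := by
    rw [hf]
    field_simp
  have hfD : f * D₁ ≤ 1 := by
    have : f * D₁ ≤ D₂ * (f * D₁) := le_mul_of_one_le_left (by positivity) hD₂0
    linarith
  have hHf : 24 * H * f ≤ 1 := by
    have h1 : (24 : ℝ) * H ≤ D₁ := by nlinarith
    nlinarith
  have h1 : D₂ * f * (12 * (H * d)) ≤ δ / 2 := by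
    have h2 : (24 : ℝ) * (H * d) ≤ D₁ := by nlinarith
    have := mul_le_mul_of_nonneg_left h2 (show 0 ≤ D₂ * f by positivity)
    linarith
  have h2 : D₂ * f * (3 * (H * L)) ≤ δ := by
    have := mul_le_mul_of_nonneg_left hD₁L (show 0 ≤ D₂ * f by positivity)
    linarith
  calc (roundBound H ε : ℝ) * (d * (2 * f) + (H + 1) * L * (2 * f ^ 2))
      ≤ 2 * H * D₂ * (d * (2 * f) + (2 * H) * L * (2 * f ^ 2)) := by
        gcongr
        linarith
    _ = 4 * (D₂ * f * (H * d)) + 8 * (D₂ * f * (H * L)) * (H * f) := by ring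
    _ ≤ 4 * (D₂ * f * (H * d)) + 8 * (D₂ * f * (H * L)) * (1 / 24) := by
        gcongr
        linarith
    _ ≤ δ := by linarith

theorem failProb_pos {L : ℕ} {ε : ℝ} (hd : 0 < d) (hε : 0 < ε) (hε1 : ε ≤ 1) (hδ : 0 < δ) :
    0 < failProb d H L ε δ := by
  have hlog := logb_inv_nonneg hε hε1
  have hd' : (0 : ℝ) < d := by exact_mod_cast hd
  unfold failProb
  positivity

theorem log_failProb_pos {L : ℕ} {ε : ℝ} (hd : 0 < d) (hH : 0 < H) (hL : 0 < L) (hε : 0 < ε)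
    (hε1 : ε ≤ 1) (hδ : 0 < δ) (hδ1 : δ < 1) : 0 < Real.log (1 / failProb d H L ε δ) := by
  have hlog := logb_inv_nonneg hε hε1
  have hd' : (1 : ℝ) ≤ d := by exact_mod_cast hd
  have h1 : (1 : ℝ) ≤ d + 3 * H * L := by
    have : (0 : ℝ) ≤ 3 * H * L := by positivity
    linarith
  have h2 : (1 : ℝ) ≤ 1 + H * Real.logb 2 (1 / ε) := by
    have : (0 : ℝ) ≤ H * Real.logb 2 (1 / ε) := by positivity
    linarith
  refine Real.log_pos ?_
  rw [lt_div_iff₀ (failProb_pos hd hε hε1 hδ), one_mul, failProb, div_lt_one (by nlinarith)]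
  nlinarith

/-- All quantities are polynomial in `X`: the two factors of the denominator and `1 / δ` are at most
`56 * X ^ 2`, `4 * X ^ 2` and `X`, and the constant `224` is below $e^6$. -/
theorem log_failProb_le {L : ℕ} {ε X : ℝ} (hd : 0 < d) (hH : 0 < H) (hϵ : 0 < ϵ)
    (hϵ1 : ϵ ≤ 8 * H) (hε : ε = ϵ / (8 * H)) (hδ : 0 < δ) (hδ1 : δ < 1)
    (hX : X = d * H * (1 + 1 / ϵ) / δ) (hL : (L : ℝ) ≤ 16 * H * d / ϵ) :
    0 ≤ Real.log X ∧ Real.logb 2 (1 / ε) ≤ 3 * (1 + Real.log X) ∧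
      Real.log (1 / failProb d H L ε δ) ≤ 6 * (1 + Real.log X) := by
  have hd' : (1 : ℝ) ≤ d := by exact_mod_cast hd
  have hH' : (1 : ℝ) ≤ H := by exact_mod_cast hH
  have hε0 : 0 < ε := by rw [hε]; positivity
  have hε1 : ε ≤ 1 := by rw [hε, div_le_one (by positivity)]; exact hϵ1
  have hdH : (1 : ℝ) ≤ d * H := by nlinarith
  have hie : 0 < 1 / ϵ := by positivity
  have hXδ : X * δ = d * H * (1 + 1 / ϵ) := by rw [hX]; field_simp
  have hX0 : 0 < X := by rw [hX]; positivity
  have hX1 : d * H * (1 + 1 / ϵ) ≤ X := by nlinarith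
  have hXdH : (d : ℝ) * H ≤ X := by nlinarith
  have hXone : 1 ≤ X := by linarith
  have hXi : d * H * (1 / ϵ) ≤ X := by nlinarith
  have hHi : H * (1 / ϵ) ≤ X := by nlinarith [mul_pos (by linarith : (0:ℝ) < H) hie]
  have hXd : 1 / δ ≤ X := by
    rw [div_le_iff₀ hδ, hXδ]
    nlinarith
  have hG : 0 ≤ Real.log X := Real.log_nonneg hXone
  have hGX : 1 + Real.log X ≤ X := by linarith [Real.log_le_sub_one_of_pos hX0]
  have hlog2 := Real.log_two_gt_d9
  have hlam : Real.logb 2 (1 / ε) ≤ 3 * (1 + Real.log X) := by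
    have h1 : 1 / ε ≤ 2 ^ 3 * X := by
      rw [hε, one_div_div]
      calc 8 * (H : ℝ) / ϵ = 8 * (H * (1 / ϵ)) := by ring
        _ ≤ _ := by linarith
    have h2 := Real.log_le_log (by positivity) h1
    rw [Real.log_mul (by norm_num) hX0.ne', Real.log_pow] at h2
    rw [Real.logb, div_le_iff₀ (by linarith)]
    push_cast at h2
    nlinarith
  refine ⟨hG, hlam, ?_⟩
  have hlam0 := logb_inv_nonneg hε0 hε1
  set lam := Real.logb 2 (1 / ε)
  have hHX : (H : ℝ) ≤ X := by nlinarith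
  have hD₁ : d + 3 * H * L ≤ 56 * X ^ 2 := by
    have h1 : (d : ℝ) ≤ 8 * (d * H * (1 / ϵ)) := by
      rw [mul_one_div, ← mul_div_assoc, le_div_iff₀ hϵ]
      nlinarith
    have h2 : (L : ℝ) ≤ 16 * (d * H * (1 / ϵ)) := hL.trans (le_of_eq (by ring))
    have h3 : (L : ℝ) ≤ 16 * X := by linarith
    have h4 : (H : ℝ) * L ≤ X * (16 * X) := mul_le_mul hHX h3 (Nat.cast_nonneg _) hX0.le
    nlinarith
  have hD₂ : 1 + H * lam ≤ 4 * X ^ 2 := by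
    have h1 : lam ≤ 3 * X := by linarith
    have h2 : H * lam ≤ X * (3 * X) := mul_le_mul hHX h1 hlam0 hX0.le
    nlinarith
  have hD₁0 : (0 : ℝ) < d + 3 * H * L := by positivity
  have hD₂0 : 0 < 1 + H * lam := by positivity
  have hexp : (224 : ℝ) ≤ Real.exp 6 := by
    have h1 : Real.exp 6 = Real.exp 1 ^ 6 := by rw [← Real.exp_nat_mul]; norm_num
    rw [h1]
    calc (224 : ℝ) ≤ 2.7 ^ 6 := by norm_num
      _ ≤ _ := pow_le_pow_left₀ (by norm_num) (by linarith [Real.exp_one_gt_d9]) 6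
  have hmain : 1 / failProb d H L ε δ ≤ Real.exp 6 * X ^ 5 := by
    rw [failProb, one_div_div, div_eq_mul_one_div]
    calc (d + 3 * H * L) * (1 + H * lam) * (1 / δ) ≤ 56 * X ^ 2 * (4 * X ^ 2) * X := by gcongr
      _ = 224 * X ^ 5 := by ring
      _ ≤ _ := by gcongr
  have h1 := Real.log_le_log (one_div_pos.2 (failProb_pos hd hε0 hε1 hδ)) hmain
  rw [Real.log_mul (Real.exp_ne_zero _) (by positivity), Real.log_exp, Real.log_pow] at h1
  push_cast at h1
  linarith

theorem gridSize_le (hd : 0 < d) (hH : 0 < H) (hϵ : 0 < ϵ) (hϵ1 : ϵ ≤ 8 * H) :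
    ((⌈1 / (ϵ / (8 * H * d))⌉₊ : ℕ) : ℝ) ≤ 16 * H * d / ϵ := by
  have hd' : (1 : ℝ) ≤ d := by exact_mod_cast hd
  have h1 := (Nat.ceil_lt_add_one (show 0 ≤ 1 / (ϵ / (8 * H * d)) by positivity)).le
  have h2 : (1 : ℝ) ≤ 8 * H * d / ϵ := by
    rw [le_div_iff₀ hϵ]
    nlinarith
  rw [one_div_div] at h1 ⊢
  refine h1.trans ?_
  calc 8 * (H : ℝ) * d / ϵ + 1 ≤ 8 * H * d / ϵ + 8 * H * d / ϵ := by linarith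
    _ = _ := by ring

theorem theParams_cost_le (hd : 0 < d) (hH : 0 < H) (hϵ : 0 < ϵ) (hϵ1 : ϵ ≤ 8 * H) (hδ : 0 < δ)
    (hδ1 : δ < 1) :
    (roundBound H (theParams d H ϵ δ).ε : ℝ) * roundCost d (theParams d H ϵ δ) ≤
      1250000 * (1 + Real.log (d * H * (1 + 1 / ϵ) / δ)) ^ 2 * (H ^ 5 * d ^ 3 / ϵ ^ 3) := by
  have hd' : (1 : ℝ) ≤ d := by exact_mod_cast hd
  have hH' : (1 : ℝ) ≤ H := by exact_mod_cast hH
  have hε0 : 0 < ϵ / (8 * H) := by positivity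
  have hε1 : ϵ / (8 * H) ≤ 1 := by rw [div_le_one (by positivity)]; exact hϵ1
  have hL := gridSize_le hd hH hϵ hϵ1
  obtain ⟨hG, hlam, hΛ⟩ := log_failProb_le hd hH hϵ hϵ1 rfl hδ hδ1 rfl hL
  have hL0 : 0 < ⌈1 / (ϵ / (8 * H * d))⌉₊ := Nat.ceil_pos.2 (by positivity)
  have hΛ0 := log_failProb_pos hd hH hL0 hε0 hε1 hδ hδ1
  set G := Real.log (d * H * (1 + 1 / ϵ) / δ)
  have hN : (roundBound H (theParams d H ϵ δ).ε : ℝ) ≤ 5 * H * (1 + G) := by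
    refine (roundBound_le (H := H) hε0 hε1).trans ?_
    nlinarith
  have hM : ∀ c : ℝ, 0 ≤ c → ((⌈2 * Real.log (1 / failProb d H ⌈1 / (ϵ / (8 * H * d))⌉₊
      (ϵ / (8 * H)) δ) * c⌉₊ : ℕ) : ℝ) ≤ 12 * (1 + G) * c + 1 := fun c hc => by
    refine (Nat.ceil_lt_add_one (by positivity)).le.trans ?_
    have := mul_le_mul_of_nonneg_right hΛ hc
    linarith
  -- Absorbs the `1` lost by rounding sample sizes up.
  have hone : (1 : ℝ) ≤ 64 * (H ^ 2 * d ^ 2 / ϵ ^ 2) := by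
    rw [← mul_div_assoc, le_div_iff₀ (by positivity)]
    have h1 : ϵ ≤ 8 * (H * d) := by nlinarith
    have h2 := pow_le_pow_left₀ hϵ.le h1 2
    linarith
  have hY : (0 : ℝ) ≤ H ^ 2 * d ^ 2 / ϵ ^ 2 := by positivity
  have hM₁ : ((theParams d H ϵ δ).M₁ : ℝ) ≤ 3136 * (1 + G) * (H ^ 2 * d ^ 2 / ϵ ^ 2) := by
    refine (hM (256 * H ^ 2 * d ^ 2 / ϵ ^ 2) (by positivity)).trans ?_
    have : 256 * (H : ℝ) ^ 2 * d ^ 2 / ϵ ^ 2 = 256 * (H ^ 2 * d ^ 2 / ϵ ^ 2) := by ring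
    rw [this]
    nlinarith
  have hM₂ : ((theParams d H ϵ δ).M₂ : ℝ) ≤ 12352 * (1 + G) * (H ^ 2 * d ^ 2 / ϵ ^ 2) := by
    refine (hM (16 * (2 + 4 * H + 2 * H * d) ^ 2 / ϵ ^ 2) (by positivity)).trans ?_
    have h1 : 16 * (2 + 4 * (H : ℝ) + 2 * H * d) ^ 2 / ϵ ^ 2 ≤ 1024 * (H ^ 2 * d ^ 2 / ϵ ^ 2) := by
      have h2 : 2 + 4 * (H : ℝ) + 2 * H * d ≤ 8 * (H * d) := by nlinarith
      calc 16 * (2 + 4 * (H : ℝ) + 2 * H * d) ^ 2 / ϵ ^ 2 ≤ 16 * (8 * (H * d)) ^ 2 / ϵ ^ 2 := by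
            gcongr
        _ = _ := by ring
    have h3 := mul_le_mul_of_nonneg_left h1 (show 0 ≤ 12 * (1 + G) by positivity)
    nlinarith
  have hcost : (roundCost d (theParams d H ϵ δ) : ℝ) ≤
      250000 * (1 + G) * (H ^ 3 * d ^ 3 / ϵ ^ 3) := by
    rw [roundCost]
    push_cast
    have h1 : (d : ℝ) + 1 ≤ 16 * H * d / ϵ := by
      rw [le_div_iff₀ hϵ]
      nlinarith
    calc ((d : ℝ) + 1) * (theParams d H ϵ δ).M₁ + (theParams d H ϵ δ).L * (theParams d H ϵ δ).M₂
        ≤ 16 * H * d / ϵ * (3136 * (1 + G) * (H ^ 2 * d ^ 2 / ϵ ^ 2)) +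
          16 * H * d / ϵ * (12352 * (1 + G) * (H ^ 2 * d ^ 2 / ϵ ^ 2)) :=
          add_le_add (mul_le_mul h1 hM₁ (Nat.cast_nonneg _) (by positivity))
            (mul_le_mul hL hM₂ (Nat.cast_nonneg _) (by positivity))
      _ = 247808 * (1 + G) * (H ^ 3 * d ^ 3 / ϵ ^ 3) := by ring
      _ ≤ _ := by gcongr; norm_num
  calc (roundBound H (theParams d H ϵ δ).ε : ℝ) * roundCost d (theParams d H ϵ δ)
      ≤ 5 * H * (1 + G) * (250000 * (1 + G) * (H ^ 3 * d ^ 3 / ϵ ^ 3)) :=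
        mul_le_mul hN hcost (Nat.cast_nonneg _) (by positivity)
    _ = 1250000 * (1 + G) ^ 2 * (H ^ 4 * d ^ 3 / ϵ ^ 3) := by ring
    -- The cost is of order `H ^ 4`; one factor `H` is given away.
    _ ≤ _ := by
      gcongr
      norm_num

/-- A grid error of `η / 2` and `τ = 3 / 4 * η` add up to `5 / 4 * η`, and `d * η = ε`. Since `η ≤ 1
/ 8`, the candidate is at most `17 / 16`, hence `B = 33 / 16`. -/
theorem theParams_sampleSize {Θ : ℝ} {l : Fin (theParams d H ϵ δ).L} (hd : 0 < d) (hH : 0 < H)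
    (hϵ : 0 < ϵ) (hϵ1 : ϵ < 1) (hδ : 0 < δ) (hδ1 : δ < 1) (hΘ : Θ ≤ 1)
    (hl : Θ ≤ (theParams d H ϵ δ).η / 2 ∨
      |(theParams d H ϵ δ).grid l - Θ| ≤ (theParams d H ϵ δ).η / 2) :
    SampleSize d (theParams d H ϵ δ) Θ (3 / 4 * (theParams d H ϵ δ).η) (33 / 16)
      (2 * failProb d H (theParams d H ϵ δ).L (theParams d H ϵ δ).ε δ)
      (2 * failProb d H (theParams d H ϵ δ).L (theParams d H ϵ δ).ε δ ^ 2)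
      (Θ ≤ (theParams d H ϵ δ).η / 2) l := by
  have hd' : (1 : ℝ) ≤ d := by exact_mod_cast hd
  have hH' : (1 : ℝ) ≤ H := by exact_mod_cast hH
  set q := theParams d H ϵ δ with hq
  have hqε : q.ε = ϵ / (8 * H) := rfl
  have hqη : q.η = ϵ / (8 * H * d) := rfl
  have hε0 : 0 < q.ε := by rw [hqε]; positivity
  have hε1 : q.ε ≤ 1 := by rw [hqε, div_le_one (by positivity)]; linarith
  have hη0 : 0 < q.η := by rw [hqη]; positivity
  have hL0 : 0 < q.L := Nat.ceil_pos.2 (one_div_pos.2 hη0)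
  have hΛ0 := log_failProb_pos hd hH hL0 hε0 hε1 hδ hδ1
  have hf0 := failProb_pos (H := H) (L := q.L) hd hε0 hε1 hδ
  have hexp : Real.exp (-Real.log (1 / failProb d H q.L q.ε δ)) = failProb d H q.L q.ε δ := by
    rw [one_div, Real.log_inv, neg_neg, Real.exp_log hf0]
  have hM₁ : 2 * Real.log (1 / failProb d H q.L q.ε δ) * (256 * H ^ 2 * d ^ 2 / ϵ ^ 2) ≤ q.M₁ :=
    Nat.le_ceil _
  have hM₂ : 2 * Real.log (1 / failProb d H q.L q.ε δ) *
      (16 * (2 + 4 * H + 2 * H * d) ^ 2 / ϵ ^ 2) ≤ q.M₂ := Nat.le_ceil _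
  set Λ := Real.log (1 / failProb d H q.L q.ε δ)
  refine ⟨hε0, hη0.le, ?_, ?_, by positivity, ?_, ?_, ?_⟩
  · exact Nat.cast_pos.1 (lt_of_lt_of_le (by positivity) hM₁)
  · exact Nat.cast_pos.1 (lt_of_lt_of_le (by positivity) hM₂)
  · refine mul_le_mul_of_nonneg_left ?_ (by norm_num)
    rw [← hexp]
    refine Real.exp_le_exp.2 (neg_le_neg ?_)
    have h1 := mul_le_mul_of_nonneg_left hM₁ (show 0 ≤ (3 / 4 * q.η) ^ 2 by positivity)
    have h2 : (3 / 4 * q.η) ^ 2 * (2 * Λ * (256 * H ^ 2 * d ^ 2 / ϵ ^ 2)) = 9 / 2 * Λ := by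
      rw [hqη]
      field_simp
      norm_num
    -- It suffices that `(33 / 16) ^ 2 ≤ 9 / 2`.
    rw [le_div_iff₀ (by norm_num)]
    linarith
  · refine mul_le_mul_of_nonneg_left ?_ (by norm_num)
    have h0 : failProb d H q.L q.ε δ ^ 2 = Real.exp (-(2 * Λ)) := by
      rw [← hexp, ← Real.exp_nat_mul]
      congr 1
      push_cast
      ring
    rw [h0]
    refine Real.exp_le_exp.2 (neg_le_neg ?_)
    have h1 := mul_le_mul_of_nonneg_left hM₂ (show 0 ≤ 2 * (q.ε / 4) ^ 2 by positivity)
    -- Already `6 * H` in place of the larger factor yields the exponent `9 / 4 * Λ`, beyond the `2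
    -- * Λ` needed for the squared failure probability.
    have h3 : 6 * (H : ℝ) ≤ 2 + 4 * H + 2 * H * d := by nlinarith
    have h4 : 2 * (q.ε / 4) ^ 2 * (2 * Λ * (16 * (6 * H) ^ 2 / ϵ ^ 2)) ≤
        2 * (q.ε / 4) ^ 2 * (2 * Λ * (16 * (2 + 4 * H + 2 * H * d) ^ 2 / ϵ ^ 2)) := by gcongr
    have h2 : 2 * (q.ε / 4) ^ 2 * (2 * Λ * (16 * (6 * H) ^ 2 / ϵ ^ 2)) = 9 / 4 * Λ := by
      rw [hqε]
      field_simp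
      norm_num
    linarith
  · refine hl.imp id fun h => ⟨?_, ?_⟩
    · have h1 : d * q.η = q.ε := by
        rw [hqη, hqε]
        field_simp
      have := mul_le_mul_of_nonneg_left h (show (0 : ℝ) ≤ d by positivity)
      linarith
    · have h1 : q.η ≤ 1 / 8 := by
        rw [hqη, div_le_iff₀ (by positivity)]
        nlinarith
      linarith [(abs_le.1 h).2]

end Numbers

end BallRL

end

/-! ### The main theorem -/

theorem theorem2 :
    ∃ (C : ℝ) (k : ℕ), 0 < C ∧
      ∀ (d H : ℕ) (_ : 0 < d) (_ : 0 < H)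
        (S : ℕ → Type*) [∀ h, MeasurableSpace (S h)] (M : BallRL.MDP d S)
        (θ : ℕ → BallRL.Vec d) (Θ : ℝ) (_ : BallRL.Assumptions M H θ Θ)
        (ϵ δ : ℝ) (_ : 0 < ϵ) (_ : 0 < δ) (_ : δ < 1)
        (best : (Fin (BallRL.theParams d H ϵ δ).L → ℝ) → Fin (BallRL.theParams d H ϵ δ).L)
        (_ : BallRL.IsArgmax best)
        (pick : BallRL.AlgState d H (BallRL.theParams d H ϵ δ).L →
          Fin H × Fin (BallRL.theParams d H ϵ δ).L)
        (_ : BallRL.IsPick (BallRL.theParams d H ϵ δ).ε pick),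
        ∃ N : ℕ,
          (∀ᵐ x ∂(BallRL.runLaw M H (BallRL.theParams d H ϵ δ) best pick N),
            BallRL.Halted (BallRL.theParams d H ϵ δ).ε x ∧
            (x.used : ℝ) ≤
              C * (1 + Real.log (d * H * (1 + 1 / ϵ) / δ)) ^ k * (H ^ 5 * d ^ 3 / ϵ ^ 3)) ∧
          ENNReal.ofReal (1 - δ) ≤
            BallRL.runLaw M H (BallRL.theParams d H ϵ δ) best pick N
              {x | BallRL.Halted (BallRL.theParams d H ϵ δ).ε x ∧ M.EpsOptimal H ϵ (x.output M)} := by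
  open BallRL in
  refine ⟨1250000, 2, by norm_num, ?_⟩
  intro d H hd hH S _ M θ Θ hA ϵ δ hϵ hδ hδ1 best hb pick hp
  have hd' : (1 : ℝ) ≤ d := by exact_mod_cast hd
  have hH' : (1 : ℝ) ≤ H := by exact_mod_cast hH
  have hqε : (theParams d H ϵ δ).ε = ϵ / (8 * H) := rfl
  have hε0 : 0 < (theParams d H ϵ δ).ε := by rw [hqε]; positivity
  rcases lt_or_ge (8 * (H : ℝ)) ϵ with hbig | hϵ8
  · have hh : Halted (theParams d H ϵ δ).ε
        (AlgState.start (best 0) : AlgState d H (theParams d H ϵ δ).L) := fun p hcon => by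
      have h1 : (1 : ℝ) < (theParams d H ϵ δ).ε := by
        rw [hqε, lt_div_iff₀ (by positivity)]
        linarith
      exact absurd hcon.2 (not_le.2 h1)
    refine ⟨0, ?_, ?_⟩
    · rw [runLaw]
      have hm : MeasurableSet {x : AlgState d H (theParams d H ϵ δ).L |
          Halted (theParams d H ϵ δ).ε x ∧ x.used = 0} :=
        (measurableSet_halted _).inter (AlgState.measurable_used (measurableSet_singleton 0))
      filter_upwards [(ae_dirac_iff hm).2 ⟨hh, rfl⟩] with x hx
      refine ⟨hx.1, ?_⟩
      rw [hx.2]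
      push_cast
      positivity
    · have hmem : (AlgState.start (best 0) : AlgState d H (theParams d H ϵ δ).L) ∈
          {x | Halted (theParams d H ϵ δ).ε x ∧ M.EpsOptimal H ϵ (x.output M)} :=
        ⟨hh, epsOptimal_of_one_le hA hH (by linarith) _⟩
      rw [runLaw, Measure.dirac_apply_of_mem hmem]
      exact ENNReal.ofReal_le_one.2 (by linarith)
  · have hε1 : (theParams d H ϵ δ).ε ≤ 1 := by
      rw [hqε, div_le_one (by positivity)]
      exact hϵ8
    have hprob := isProbabilityMeasure_runLaw H M (theParams d H ϵ δ) hb.meas hp.meas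
      (roundBound H (theParams d H ϵ δ).ε)
    have hae := ae_runLaw_halted hA hb.meas hp hε0 (one_lt_two_pow_mul hε0)
      (Nat.lt_succ_self _ : _ < roundBound H (theParams d H ϵ δ).ε)
    refine ⟨roundBound H (theParams d H ϵ δ).ε, ?_, ?_⟩
    · filter_upwards [hae] with x hx
      refine ⟨hx.1, le_trans ?_ (theParams_cost_le hd hH hϵ hϵ8 hδ hδ1)⟩
      exact_mod_cast hx.2
    -- For `1 ≤ ϵ` every greedy policy is good enough, as all values lie in `[0, 1]`. The case `ϵ <
    -- 1` gives `η ≤ 1 / 8` and `8 * H * d ≤ L`.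
    · rcases le_or_gt 1 ϵ with hϵ1 | hϵ1
      · have h1 : (Set.univ : Set (AlgState d H (theParams d H ϵ δ).L)) ≤ᵐ[runLaw M H
            (theParams d H ϵ δ) best pick (roundBound H (theParams d H ϵ δ).ε)]
            {x | Halted (theParams d H ϵ δ).ε x ∧ M.EpsOptimal H ϵ (x.output M)} :=
          hae.mono fun x hx _ => ⟨hx.1, epsOptimal_of_one_le hA hH hϵ1 _⟩
        refine le_trans ?_ (measure_mono_ae h1)
        rw [measure_univ]
        exact ENNReal.ofReal_le_one.2 (by linarith)
      · have hη0 : 0 < (theParams d H ϵ δ).η := div_pos hϵ (by positivity)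
        have hηε : (theParams d H ϵ δ).η ≤ (theParams d H ϵ δ).ε :=
          div_le_div_of_nonneg_left hϵ.le (by positivity)
            (le_mul_of_one_le_right (by positivity) hd')
        obtain ⟨l, hl⟩ : ∃ l : Fin (theParams d H ϵ δ).L, Θ ≤ (theParams d H ϵ δ).η / 2 ∨
            |(theParams d H ϵ δ).grid l - Θ| ≤ (theParams d H ϵ δ).η / 2 := by
          rcases le_or_gt Θ ((theParams d H ϵ δ).η / 2) with h | h
          -- For such small `Θ` the index is irrelevant: no direction loses more than `2 * Θ ≤ η ≤
          -- ε` per unit of radius.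
          · exact ⟨best 0, Or.inl h⟩
          · obtain ⟨l, hl⟩ := exists_grid_point hη0 h hA.norm_le
            exact ⟨l, Or.inr hl⟩
        have hs := theParams_sampleSize hd hH hϵ hϵ1 hδ hδ1 hA.norm_le hl
        have hL : 8 * H * d ≤ (theParams d H ϵ δ).L := by
          have h1 : (1 : ℝ) / (theParams d H ϵ δ).η ≤ (theParams d H ϵ δ).L := Nat.le_ceil _
          have h2 : (1 : ℝ) / (theParams d H ϵ δ).η = 8 * H * d / ϵ := one_div_div _ _
          have h3 : (8 : ℝ) * H * d ≤ 8 * H * d / ϵ := by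
            rw [le_div_iff₀ hϵ]
            exact mul_le_of_le_one_right (by positivity) hϵ1.le
          exact_mod_cast h3.trans (h2 ▸ h1)
        have hbad : runLaw M H (theParams d H ϵ δ) best pick (roundBound H (theParams d H ϵ δ).ε)
            {x | ¬ Good M θ Θ (theParams d H ϵ δ) (Θ ≤ (theParams d H ϵ δ).η / 2) l x} ≤
              ENNReal.ofReal δ := by
          refine (runLaw_not_good_le hA hH hb hp hs hε1 _).trans ?_
          rw [← ENNReal.ofReal_natCast, ← ENNReal.ofReal_mul (Nat.cast_nonneg _)]
          exact ENNReal.ofReal_le_ofReal (total_failure_le hd hH hε0 hε1 hδ hδ1 hL)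
        -- Covering the space and using subadditivity avoids having to show that the set of
        -- successful outcomes is measurable.
        have hcover : (Set.univ : Set (AlgState d H (theParams d H ϵ δ).L)) ≤ᵐ[runLaw M H
            (theParams d H ϵ δ) best pick (roundBound H (theParams d H ϵ δ).ε)]
            ({x | Halted (theParams d H ϵ δ).ε x ∧ M.EpsOptimal H ϵ (x.output M)} ∪
              {x | ¬ Good M θ Θ (theParams d H ϵ δ) (Θ ≤ (theParams d H ϵ δ).η / 2) l x} :
              Set (AlgState d H (theParams d H ϵ δ).L)) := by
          filter_upwards [hae] with x hx _
          by_cases hg : Good M θ Θ (theParams d H ϵ δ) (Θ ≤ (theParams d H ϵ δ).η / 2) l x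
          · refine Or.inl ⟨hx.1, epsOptimal_of_good hA hH hε0 (le_of_eq ?_) (fun h => ?_) hg hx.1⟩
            · rw [hqε]
              field_simp
            · linarith
          · exact Or.inr hg
        have h1 := (measure_mono_ae hcover).trans (measure_union_le _ _)
        rw [measure_univ] at h1
        rw [ENNReal.ofReal_sub _ hδ.le, ENNReal.ofReal_one]
        exact tsub_le_iff_right.2 (h1.trans (add_le_add le_rfl hbad))
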